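/- Let $T^2=S^1\times S^1$ be the two-dimensional torus and let $L\to T^2$ be a smooth complex line bundle, of degree $\deg L=\langle c_1(L),[T^2]\rangle\in\mathbb{Z}$. Let $\Gamma$ be a finite group acting smoothly and effectively on the total space of $L$ by complex vector bundle automorphisms (each $\gamma\in\Gamma$ maps every fibre $L_x$ to the fibre $L_{\gamma\cdot x}$ by a $\mathbb{C}$-linear isomorphism, where $x\mapsto\gamma\cdot x$ denotes the induced smooth action of $\Gamma$ on $T^2$), and assume that the induced action of $\Gamma$ on $T^2$ preserves the orientation. Then there is an abelian subgroup $\Gamma_{\mathrm{ab}}\subseteq\Gamma$ such that $$[\Gamma:\Gamma_{\mathrm{ab}}]\leq 6\cdot\max\{1,|\deg L|\}.$$ Suppose in addition that $\Gamma$ acts trivially on $H^1(T^2;\mathbb{Z})$ and that the induced action of $\Gamma$ on $T^2$ factors through a free action of an abelian quotient of $\Gamma$ which can be generated by two (not necessarily distinct) elements. Then there is an abelian subgroup $\Gamma_{\mathrm{ab}}\subseteq\Gamma$ such that $$[\Gamma:\Gamma_{\mathrm{ab}}]\leq \max\{1,|\deg L|\}.$$ -/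

import Mathlib

open Bundle Topology
open scoped Manifold ContDiff

/-! ### The two-dimensional torus -/

/-- The torus `T² = S¹ × S¹`, with the product smooth structure of Mathlib. -/
abbrev Torus : Type := Circle × Circle

/-- The model with corners of the smooth manifold `T² = S¹ × S¹`. -/
noncomputable abbrev torusModel :
    ModelWithCorners ℝ (EuclideanSpace ℝ (Fin 1) × EuclideanSpace ℝ (Fin 1))
      (ModelProd (EuclideanSpace ℝ (Fin 1)) (EuclideanSpace ℝ (Fin 1))) :=
  (𝓡 1).prod (𝓡 1)

/-- The universal covering `ℝ² → T²`, `(s, t) ↦ (exp (2πis), exp (2πit))`. -/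
noncomputable def torusCover (z : ℝ × ℝ) : Torus :=
  (Circle.exp (2 * Real.pi * z.1), Circle.exp (2 * Real.pi * z.2))

lemma continuous_torusCover : Continuous torusCover := by
  unfold torusCover
  fun_prop

/-- A self-map of `T²` preserves the orientation if, in the local coordinates `(s, t)` given by the
covering `ℝ² → T²` at any point and at its image, it is represented by a map whose derivative
has positive determinant. -/
def TorusOrientationPreserving (f : Torus → Torus) : Prop :=
  ∀ x y : ℝ × ℝ, torusCover y = f (torusCover x) →
    ∃ F : ℝ × ℝ → ℝ × ℝ, F x = y ∧ (∀ᶠ z in 𝓝 x, torusCover (F z) = f (torusCover z)) ∧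
      DifferentiableAt ℝ F x ∧ 0 < (fderiv ℝ F x).det

/-! ### First singular cohomology with integer coefficients -/

section Cohomology

variable {X Y : Type*} [TopologicalSpace X] [TopologicalSpace Y]

/-- Singular `n`-simplices of `X`. -/
abbrev SingSimplex (n : ℕ) (X : Type*) [TopologicalSpace X] : Type _ :=
  C(stdSimplex ℝ (Fin (n + 1)), X)

/-- The `i`-th face of a singular simplex. -/
noncomputable def SingSimplex.face {n : ℕ} (σ : SingSimplex (n + 1) X) (i : Fin (n + 2)) :
    SingSimplex n X :=
  σ.comp ⟨stdSimplex.map i.succAbove, stdSimplex.continuous_map _⟩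

/-- The coboundary `(δc)(σ) = ∑ᵢ (-1)ⁱ c(dᵢσ)` on integral singular cochains. -/
noncomputable def singCoboundary (n : ℕ) (X : Type*) [TopologicalSpace X] :
    (SingSimplex n X → ℤ) →+ (SingSimplex (n + 1) X → ℤ) where
  toFun c σ := ∑ i : Fin (n + 2), (-1) ^ (i : ℕ) * c (σ.face i)
  map_zero' := by ext σ; simp
  map_add' c c' := by ext σ; simp [mul_add, Finset.sum_add_distrib]

/-- Pullback of cochains along a continuous map. -/
def singPullback (n : ℕ) (f : C(X, Y)) : (SingSimplex n Y → ℤ) →+ (SingSimplex n X → ℤ) where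
  toFun c σ := c (f.comp σ)
  map_zero' := rfl
  map_add' _ _ := rfl

lemma singCoboundary_pullback (n : ℕ) (f : C(X, Y)) (c : SingSimplex n Y → ℤ) :
    singCoboundary n X (singPullback n f c) = singPullback (n + 1) f (singCoboundary n Y c) := rfl

/-- `H¹(X; ℤ)`: singular `1`-cocycles modulo coboundaries of `0`-cochains. -/
abbrev SingH1 (X : Type*) [TopologicalSpace X] : Type _ :=
  (singCoboundary 1 X).ker ⧸ (singCoboundary 0 X).range.addSubgroupOf (singCoboundary 1 X).ker

/-- The pullback `f^* : H¹(Y; ℤ) → H¹(X; ℤ)`. -/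
noncomputable def SingH1.map (f : C(X, Y)) : SingH1 Y →+ SingH1 X :=
  QuotientAddGroup.map _ _
    (((singPullback 1 f).comp (singCoboundary 1 Y).ker.subtype).codRestrict (singCoboundary 1 X).ker
      (fun c => by
        rw [AddMonoidHom.mem_ker, AddMonoidHom.comp_apply, singCoboundary_pullback]
        have hc : singCoboundary 1 Y c = 0 := c.2
        simp [hc]))
    (by
      rintro ⟨c, hc⟩ ⟨b, hb⟩
      exact ⟨singPullback 0 f b, by
        rw [singCoboundary_pullback, hb]
        rfl⟩)

end Cohomology

/-! ### Complex line bundles -/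

section RealStructure

variable {B : Type*} [TopologicalSpace B] (E : B → Type*)
  [∀ x, AddCommGroup (E x)] [∀ x, Module ℂ (E x)] [TopologicalSpace (TotalSpace ℂ E)]
  [∀ x, TopologicalSpace (E x)] [FiberBundle ℂ E] [VectorBundle ℂ ℂ E]

/-- The real vector bundle (of rank two) underlying a complex line bundle. Smoothness over a real
base manifold is smoothness of this real vector bundle. -/
instance lineBundleReal : VectorBundle ℝ ℂ E where
  trivialization_linear' e _ :=
    { linear := fun b hb =>
        { map_add := (e.linear ℂ hb).map_add
          map_smul := fun r v => by
            have := (e.linear ℂ hb).map_smul (r : ℂ) v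
            simpa using this } }
  continuousOn_coordChange' e e' _ _ := by
    have h := (ContinuousLinearMap.continuous_restrictScalars (𝕜 := ℂ) (E := ℂ) (F := ℂ)
      (𝕜' := ℝ)).comp_continuousOn (continuousOn_coordChange ℂ e e')
    refine h.congr fun b hb => ?_
    ext v
    simp [Trivialization.coordChangeL_apply e e' hb]

end RealStructure

/-! ### The degree of a complex line bundle over the torus -/

section Degree

/-- Fibrewise multiplication by a complex number. -/
def fiberSMul {B : Type*} {E : B → Type*} [∀ x, AddCommGroup (E x)] [∀ x, Module ℂ (E x)]
    (c : ℂ) (v : TotalSpace ℂ E) : TotalSpace ℂ E :=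
  ⟨v.proj, c • v.2⟩

lemma fiberSMul_mul {B : Type*} {E : B → Type*} [∀ x, AddCommGroup (E x)] [∀ x, Module ℂ (E x)]
    (c d : ℂ) (v : TotalSpace ℂ E) :
    fiberSMul c (fiberSMul d v) = fiberSMul (c * d) v :=
  congrArg (TotalSpace.mk v.proj) (mul_smul c d v.2).symm

lemma fiberSMul_left_injective {B : Type*} {E : B → Type*} [∀ x, AddCommGroup (E x)]
    [∀ x, Module ℂ (E x)] {c d : ℂ} {v : TotalSpace ℂ E} (hv : v.2 ≠ 0)
    (h : fiberSMul c v = fiberSMul d v) : c = d := by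
  simp only [fiberSMul, TotalSpace.mk_inj] at h
  exact smul_left_injective ℂ hv h

section Sections

variable {B : Type*} [TopologicalSpace B] {E : B → Type*}
  [∀ x, AddCommGroup (E x)] [∀ x, Module ℂ (E x)] [TopologicalSpace (TotalSpace ℂ E)]
  [∀ x, TopologicalSpace (E x)] [FiberBundle ℂ E] [VectorBundle ℂ ℂ E]

lemma trivialization_smul (e : Trivialization ℂ (π ℂ E)) [MemTrivializationAtlas e] {b : B}
    (hb : b ∈ e.baseSet) (c : ℂ) (v : E b) : (e ⟨b, c • v⟩).2 = c * (e ⟨b, v⟩).2 :=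
  (e.linear ℂ hb).map_smul c v

lemma trivialization_ne_zero (e : Trivialization ℂ (π ℂ E)) [MemTrivializationAtlas e] {b : B}
    (hb : b ∈ e.baseSet) {v : E b} (hv : v ≠ 0) : (e ⟨b, v⟩).2 ≠ 0 := by
  have h := (e.linearEquivAt ℂ b hb).map_ne_zero_iff.2 hv
  simpa using h

/-- Two nowhere vanishing sections along the same map differ by a continuous factor. -/
lemma exists_factor {Z : Type*} [TopologicalSpace Z] {S : Set Z} {f g : Z → TotalSpace ℂ E}
    (hf : ContinuousOn f S) (hg : ContinuousOn g S) (hfg : ∀ z ∈ S, (f z).proj = (g z).proj)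
    (hf0 : ∀ z ∈ S, (f z).2 ≠ 0) (hg0 : ∀ z ∈ S, (g z).2 ≠ 0) :
    ∃ c : Z → ℂ, ContinuousOn c S ∧ ∀ z ∈ S, c z ≠ 0 ∧ f z = fiberSMul (c z) (g z) := by
  let r : Z → ℂ := fun z =>
    (trivializationAt ℂ E (f z).proj (f z)).2 / (trivializationAt ℂ E (f z).proj (g z)).2
  have key : ∀ z ∈ S, ∀ e : Trivialization ℂ (π ℂ E), ∀ _ : MemTrivializationAtlas e,
      (f z).proj ∈ e.baseSet → r z = (e (f z)).2 / (e (g z)).2 := by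
    intro z hz e he hb
    have hp := hfg z hz
    have h0 := hf0 z hz
    have h1 := hg0 z hz
    dsimp only [r]
    generalize f z = v at *
    generalize g z = w at *
    obtain ⟨b, v⟩ := v
    obtain ⟨b', w⟩ := w
    obtain rfl : b = b' := hp
    have hb' : b ∈ (trivializationAt ℂ E b).baseSet := FiberBundle.mem_baseSet_trivializationAt' b
    obtain ⟨c, rfl⟩ : ∃ c : ℂ, v = c • w := by
      have h2 := trivialization_ne_zero (trivializationAt ℂ E b) hb' h1
      refine ⟨(trivializationAt ℂ E b ⟨b, v⟩).2 / (trivializationAt ℂ E b ⟨b, w⟩).2, ?_⟩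
      apply ((trivializationAt ℂ E b).linearEquivAt ℂ b hb').injective
      rw [map_smul]
      simp only [Trivialization.linearEquivAt_apply, smul_eq_mul]
      field_simp
    change (trivializationAt ℂ E b ⟨b, c • w⟩).2 / (trivializationAt ℂ E b ⟨b, w⟩).2 = _
    rw [trivialization_smul _ hb', trivialization_smul e hb,
      mul_div_cancel_right₀ _ (trivialization_ne_zero _ hb' h1),
      mul_div_cancel_right₀ _ (trivialization_ne_zero e hb h1)]
  refine ⟨r, ?_, ?_⟩
  · intro z hz
    have hb' := FiberBundle.mem_baseSet_trivializationAt' (F := ℂ) (E := E) (f z).proj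
    set e := trivializationAt ℂ E (f z).proj with he
    have h1 := (FiberBundle.continuousWithinAt_totalSpace ℂ _).1 (hf z hz)
    have h2 := (FiberBundle.continuousWithinAt_totalSpace ℂ _).1 (hg z hz)
    rw [← hfg z hz] at h2
    have h3 : (e (g z)).2 ≠ 0 :=
      trivialization_ne_zero e (b := (g z).proj) (by rw [← hfg z hz]; exact hb') (hg0 z hz)
    refine (h1.2.div h2.2 h3).congr_of_eventuallyEq ?_ (key z hz e inferInstance hb')
    have := h1.1 (e.open_baseSet.mem_nhds hb')
    filter_upwards [this, self_mem_nhdsWithin] with y hy hyS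
    exact key y hyS e inferInstance hy
  · intro z hz
    have hb := FiberBundle.mem_baseSet_trivializationAt' (F := ℂ) (E := E) (f z).proj
    have h := key z hz (trivializationAt ℂ E (f z).proj) inferInstance hb
    have hp := hfg z hz
    have h0 := hf0 z hz
    have h1 := hg0 z hz
    rw [h]
    generalize f z = v at *
    generalize g z = w at *
    obtain ⟨b, v⟩ := v
    obtain ⟨b', w⟩ := w
    obtain rfl : b = b' := hp
    have hv := trivialization_ne_zero (trivializationAt ℂ E b) hb h0
    have hw := trivialization_ne_zero (trivializationAt ℂ E b) hb h1
    refine ⟨div_ne_zero hv hw, ?_⟩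
    simp only [fiberSMul, TotalSpace.mk_inj]
    apply ((trivializationAt ℂ E b).linearEquivAt ℂ b hb).injective
    rw [map_smul]
    simp only [Trivialization.linearEquivAt_apply, smul_eq_mul]
    field_simp

lemma continuousOn_fiberSMul {Z : Type*} [TopologicalSpace Z] {S : Set Z}
    {f : Z → TotalSpace ℂ E} {c : Z → ℂ} (hf : ContinuousOn f S) (hc : ContinuousOn c S) :
    ContinuousOn (fun z => fiberSMul (c z) (f z)) S := by
  intro z hz
  have hb' := FiberBundle.mem_baseSet_trivializationAt' (F := ℂ) (E := E) (f z).proj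
  have h1 := (FiberBundle.continuousWithinAt_totalSpace ℂ _).1 (hf z hz)
  refine (FiberBundle.continuousWithinAt_totalSpace ℂ _).2 ⟨h1.1, ?_⟩
  change ContinuousWithinAt
    (fun y => (trivializationAt ℂ E (f z).proj ⟨(f y).proj, c y • (f y).2⟩).2) S z
  refine ((hc z hz).mul h1.2).congr_of_eventuallyEq ?_ (trivialization_smul _ hb' _ _)
  have := h1.1 ((trivializationAt ℂ E (f z).proj).open_baseSet.mem_nhds hb')
  filter_upwards [this] with y hy
  exact trivialization_smul _ hy _ _

variable (E) in
/-- There is a nowhere vanishing continuous section over `S` of the pullback of `E` along `g`. -/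
def HasSectionOn {Z : Type*} [TopologicalSpace Z] (g : Z → B) (S : Set Z) : Prop :=
  ∃ τ : Z → TotalSpace ℂ E, ContinuousOn τ S ∧ ∀ z ∈ S, (τ z).proj = g z ∧ (τ z).2 ≠ 0

lemma hasSectionOn_of_trivial {Z : Type*} [TopologicalSpace Z] {g : Z → B} (hg : Continuous g)
    {S : Set Z} (e : Trivialization ℂ (π ℂ E)) [MemTrivializationAtlas e]
    (hS : S ⊆ g ⁻¹' e.baseSet) : HasSectionOn E g S := by
  have hm : ∀ z ∈ S, (g z, (1 : ℂ)) ∈ e.target := fun z hz => e.mem_target.2 (hS hz)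
  refine ⟨fun z => e.toOpenPartialHomeomorph.symm (g z, 1), ?_, fun z hz => ⟨?_, ?_⟩⟩
  · exact e.toOpenPartialHomeomorph.continuousOn_symm.comp
      (f := fun z => (g z, (1 : ℂ))) (by fun_prop) hm
  · exact e.proj_symm_apply (hm z hz)
  · intro h0
    have h1 := e.apply_symm_apply (hm z hz)
    have hb : (e.toOpenPartialHomeomorph.symm (g z, (1 : ℂ))).proj ∈ e.baseSet := by
      have := e.proj_symm_apply (hm z hz)
      simp only at this
      rw [this]
      exact hS hz
    change (e.toOpenPartialHomeomorph.symm (g z, (1 : ℂ))).2 = 0 at h0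
    generalize e.toOpenPartialHomeomorph.symm (g z, (1 : ℂ)) = v at h0 h1 hb
    obtain ⟨b, v⟩ := v
    change v = 0 at h0
    subst h0
    have h2 : (e ⟨b, 0⟩).2 = 0 := (e.linear ℂ hb).map_zero
    have h3 : (e ⟨b, 0⟩).2 = 1 := by
      have := congrArg Prod.snd h1
      exact this
    rw [h2] at h3
    exact zero_ne_one h3

lemma HasSectionOn.union {Z : Type*} [TopologicalSpace Z] {g : Z → B} {S T : Set Z}
    (hS : HasSectionOn E g S) (hT : HasSectionOn E g T) (hSc : IsClosed S) (hTc : IsClosed T)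
    (r : Z → Z) (hr : Continuous r) (hrT : ∀ z ∈ T, r z ∈ S ∩ T) (hrST : ∀ z ∈ S ∩ T, r z = z) :
    HasSectionOn E g (S ∪ T) := by
  classical
  obtain ⟨τ, hτ, hτ'⟩ := hS
  obtain ⟨υ, hυ, hυ'⟩ := hT
  obtain ⟨c, hc, hc'⟩ := exists_factor (hτ.mono Set.inter_subset_left)
    (hυ.mono Set.inter_subset_right)
    (fun z hz => (hτ' z hz.1).1.trans (hυ' z hz.2).1.symm)
    (fun z hz => (hτ' z hz.1).2) (fun z hz => (hυ' z hz.2).2)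
  have hυc : ContinuousOn (fun z => fiberSMul (c (r z)) (υ z)) T :=
    continuousOn_fiberSMul hυ (hc.comp hr.continuousOn hrT)
  have hT : ∀ z ∈ T, S.piecewise τ (fun z => fiberSMul (c (r z)) (υ z)) z
      = fiberSMul (c (r z)) (υ z) := by
    intro z hz
    by_cases hzS : z ∈ S
    · rw [Set.piecewise_eq_of_mem _ _ _ hzS, hrST z ⟨hzS, hz⟩]
      exact (hc' z ⟨hzS, hz⟩).2
    · rw [Set.piecewise_eq_of_notMem _ _ _ hzS]
  refine ⟨S.piecewise τ fun z => fiberSMul (c (r z)) (υ z), ?_, ?_⟩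
  · exact ContinuousOn.union_of_isClosed
      (hτ.congr fun z hz => Set.piecewise_eq_of_mem _ _ _ hz)
      (hυc.congr hT) hSc hTc
  · rintro z (hz | hz)
    · rw [Set.piecewise_eq_of_mem _ _ _ hz]
      exact hτ' z hz
    · rw [hT z hz]
      exact ⟨(hυ' z hz).1, smul_ne_zero (hc' _ (hrT z hz)).1 (hυ' z hz).2⟩

/-- Line bundles over the square are trivial. -/
lemma hasSectionOn_square {g : unitInterval × unitInterval → B} (hg : Continuous g) :
    HasSectionOn E g Set.univ := by
  obtain ⟨t, ht0, htm, ⟨N, hN⟩, ht⟩ :=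
    exists_monotone_Icc_subset_open_cover_unitInterval_prod_self
      (c := fun b : B => g ⁻¹' (trivializationAt ℂ E b).baseSet)
      (fun b => (trivializationAt ℂ E b).open_baseSet.preimage hg)
      (fun z _ => Set.mem_iUnion.2 ⟨g z, FiberBundle.mem_baseSet_trivializationAt' (g z)⟩)
  have hsmall : ∀ n m,
      HasSectionOn E g (Set.Icc (t n) (t (n + 1)) ×ˢ Set.Icc (t m) (t (m + 1))) := by
    intro n m
    obtain ⟨b, hb⟩ := ht n m
    exact hasSectionOn_of_trivial hg (trivializationAt ℂ E b) hb
  have hIcc : ∀ n, Set.Icc 0 (t n) ∪ Set.Icc (t n) (t (n + 1)) = Set.Icc 0 (t (n + 1)) :=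
    fun n => Set.Icc_union_Icc_eq_Icc unitInterval.nonneg' (htm n.le_succ)
  have hmeet : ∀ n x, x ∈ Set.Icc 0 (t n) → x ∈ Set.Icc (t n) (t (n + 1)) → t n = x :=
    fun n x h1 h2 => le_antisymm h2.1 h1.2
  have hrow : ∀ m n, HasSectionOn E g (Set.Icc 0 (t (n + 1)) ×ˢ Set.Icc (t m) (t (m + 1))) := by
    intro m n
    induction n with
    | zero => simpa [ht0] using hsmall 0 m
    | succ n ih =>
      rw [← hIcc (n + 1), Set.union_prod]
      refine ih.union (hsmall (n + 1) m) (isClosed_Icc.prod isClosed_Icc)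
        (isClosed_Icc.prod isClosed_Icc) (fun z => (t (n + 1), z.2)) (by fun_prop) ?_ ?_
      · intro z hz
        exact ⟨⟨⟨unitInterval.nonneg', le_rfl⟩, hz.2⟩, ⟨⟨le_rfl, htm (Nat.le_succ _)⟩, hz.2⟩⟩
      · intro z hz
        exact Prod.ext (hmeet _ _ hz.1.1 hz.2.1) rfl
  have hcol : ∀ m, HasSectionOn E g (Set.Icc 0 (t (N + 1)) ×ˢ Set.Icc 0 (t (m + 1))) := by
    intro m
    induction m with
    | zero => simpa [ht0] using hrow 0 N
    | succ m ih =>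
      rw [← hIcc (m + 1), Set.prod_union]
      refine ih.union (hrow (m + 1) N) (isClosed_Icc.prod isClosed_Icc)
        (isClosed_Icc.prod isClosed_Icc) (fun z => (z.1, t (m + 1))) (by fun_prop) ?_ ?_
      · intro z hz
        exact ⟨⟨hz.1, ⟨unitInterval.nonneg', le_rfl⟩⟩, ⟨hz.1, ⟨le_rfl, htm (Nat.le_succ _)⟩⟩⟩
      · intro z hz
        exact Prod.ext rfl (hmeet _ _ hz.1.2 hz.2.2)
  have h := hcol N
  rw [hN (N + 1) (Nat.le_succ _)] at h
  have h1 : Set.Icc (0 : unitInterval) 1 = Set.univ := Set.Icc_bot_top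
  rwa [h1, Set.univ_prod_univ] at h

end Sections

/-- A nowhere vanishing continuous function on a retract of a simply connected space has a
continuous logarithm. -/
lemma exists_continuous_log_of_retract {A Z : Type*} [TopologicalSpace A] [TopologicalSpace Z]
    [SimplyConnectedSpace A] [LocallyPathConnectedSpace A] {i : Z → A} {r : A → Z}
    (hi : Continuous i) (hr : Continuous r) (hri : ∀ z, r (i z) = z)
    {f : Z → ℂ} (hf : Continuous f) (h0 : ∀ x, f x ≠ 0) :
    ∃ k : Z → ℂ, Continuous k ∧ ∀ x, Complex.exp (k x) = f x := by
  obtain ⟨a₀⟩ : Nonempty A := inferInstance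
  obtain ⟨F, ⟨-, hF⟩, -⟩ := Complex.isCoveringMapOn_exp.existsUnique_continuousMap_lifts
    ⟨f ∘ r, hf.comp hr⟩ (a₀ := a₀) (Complex.exp_log (h0 (r a₀))) (fun a => h0 (r a))
  refine ⟨F ∘ i, F.continuous.comp hi, fun x => ?_⟩
  have := congrFun hF (i x)
  simpa [hri] using this

lemma exists_continuous_log_interval {f : unitInterval → ℂ} (hf : Continuous f)
    (h0 : ∀ x, f x ≠ 0) : ∃ k : unitInterval → ℂ, Continuous k ∧ ∀ x, Complex.exp (k x) = f x :=
  exists_continuous_log_of_retract (A := ℝ) (Z := unitInterval) (i := fun x => (x : ℝ))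
    (r := Set.projIcc 0 1 zero_le_one) (by fun_prop) continuous_projIcc (by simp) hf h0

lemma exists_continuous_log_square {f : unitInterval × unitInterval → ℂ} (hf : Continuous f)
    (h0 : ∀ x, f x ≠ 0) :
    ∃ k : unitInterval × unitInterval → ℂ, Continuous k ∧ ∀ x, Complex.exp (k x) = f x :=
  exists_continuous_log_of_retract (A := ℝ × ℝ) (i := fun x => ((x.1 : ℝ), (x.2 : ℝ)))
    (r := Prod.map (Set.projIcc 0 1 zero_le_one) (Set.projIcc 0 1 zero_le_one)) (by fun_prop)
    (continuous_projIcc.prodMap continuous_projIcc) (by simp) hf h0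

lemma exp_eq_one_const {k : unitInterval → ℂ} (hk : Continuous k)
    (h : ∀ x, Complex.exp (k x) = 1) : k 1 = k 0 := by
  have h1 := Complex.isCoveringMap_exp.eq_of_comp_eq (g₁ := k) (g₂ := fun _ => k 0) hk
    continuous_const (by ext x; simp [h]) 0 rfl
  exact congrFun h1 1

variable (E : Torus → Type*)
  [∀ x, AddCommGroup (E x)] [∀ x, Module ℂ (E x)] [TopologicalSpace (TotalSpace ℂ E)]
  [∀ x, TopologicalSpace (E x)] [FiberBundle ℂ E] [VectorBundle ℂ ℂ E]

/-- `d` is the degree `⟨c₁(E), [T²]⟩` of the line bundle `E` over the (oriented) torus, in terms of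
multipliers: let `τ` be a nowhere vanishing section of the pullback of `E` to the unit square under
the covering `ℝ² → T²`; on opposite sides of the square it is related by
`τ(1, t) = exp (a t) τ(0, t)` and `τ(s, 1) = exp (b s) τ(s, 0)` with continuous `a` and `b`, and
`d` is the winding number of `exp b` minus that of `exp a`, i.e.
`2πi d = (b 1 - b 0) - (a 1 - a 0)`. This is the obstruction to a nowhere vanishing section
of `E` itself, i.e. the number of zeros, with signs, of a generic section. -/
def IsLineDegree (d : ℤ) : Prop :=
  ∃ (τ : unitInterval × unitInterval → TotalSpace ℂ E) (a b : unitInterval → ℂ),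
    Continuous τ ∧ Continuous a ∧ Continuous b ∧
    (∀ z, (τ z).proj = torusCover (z.1, z.2) ∧ (τ z).2 ≠ 0) ∧
    (∀ t, τ (1, t) = fiberSMul (Complex.exp (a t)) (τ (0, t))) ∧
    (∀ s, τ (s, 1) = fiberSMul (Complex.exp (b s)) (τ (s, 0))) ∧
    (b 1 - b 0) - (a 1 - a 0) = 2 * Real.pi * Complex.I * d

lemma exists_isLineDegree : ∃ d, IsLineDegree E d := by
  obtain ⟨τ, hτ, hτ'⟩ := hasSectionOn_square (E := E)
    (g := fun z : unitInterval × unitInterval => torusCover (z.1, z.2))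
    (continuous_torusCover.comp (by fun_prop))
  rw [continuousOn_univ] at hτ
  have hp : ∀ z, (τ z).proj = torusCover (z.1, z.2) := fun z => (hτ' z trivial).1
  have h0 : ∀ z, (τ z).2 ≠ 0 := fun z => (hτ' z trivial).2
  have hc1 : ∀ t : unitInterval, (τ (1, t)).proj = (τ (0, t)).proj := by
    intro t
    rw [hp, hp]
    simp [torusCover]
  have hc2 : ∀ s : unitInterval, (τ (s, 1)).proj = (τ (s, 0)).proj := by
    intro s
    rw [hp, hp]
    simp [torusCover]
  obtain ⟨u, hu, hu'⟩ := exists_factor (S := Set.univ)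
    (f := fun t : unitInterval => τ (1, t)) (g := fun t => τ (0, t))
    (by fun_prop) (by fun_prop) (fun t _ => hc1 t) (fun t _ => h0 _) (fun t _ => h0 _)
  obtain ⟨v, hv, hv'⟩ := exists_factor (S := Set.univ)
    (f := fun s : unitInterval => τ (s, 1)) (g := fun s => τ (s, 0))
    (by fun_prop) (by fun_prop) (fun t _ => hc2 t) (fun t _ => h0 _) (fun t _ => h0 _)
  obtain ⟨a, ha, ha'⟩ := exists_continuous_log_interval (continuousOn_univ.1 hu) fun t => (hu' t trivial).1
  obtain ⟨b, hb, hb'⟩ := exists_continuous_log_interval (continuousOn_univ.1 hv) fun t => (hv' t trivial).1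
  have e1 : ∀ t, τ (1, t) = fiberSMul (Complex.exp (a t)) (τ (0, t)) := fun t => by
    rw [ha']; exact (hu' t trivial).2
  have e2 : ∀ s, τ (s, 1) = fiberSMul (Complex.exp (b s)) (τ (s, 0)) := fun t => by
    rw [hb']; exact (hv' t trivial).2
  have e3 : fiberSMul (Complex.exp (a 1) * Complex.exp (b 0)) (τ (0, 0))
      = fiberSMul (Complex.exp (b 1) * Complex.exp (a 0)) (τ (0, 0)) := by
    rw [← fiberSMul_mul, ← fiberSMul_mul, ← e1, ← e2, ← e1, ← e2]
  have e4 := fiberSMul_left_injective (h0 _) e3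
  rw [← Complex.exp_add, ← Complex.exp_add, Complex.exp_eq_exp_iff_exists_int] at e4
  obtain ⟨n, hn⟩ := e4
  refine ⟨-n, τ, a, b, hτ, ha, hb, fun z => ⟨hp z, h0 z⟩, e1, e2, ?_⟩
  push_cast
  linear_combination -hn

variable {E} in
lemma IsLineDegree.unique {d d' : ℤ} (h : IsLineDegree E d) (h' : IsLineDegree E d') : d = d' := by
  obtain ⟨τ, a, b, hτ, ha, hb, hp, h1, h2, h3⟩ := h
  obtain ⟨τ', a', b', hτ', ha', hb', hp', h1', h2', h3'⟩ := h'
  obtain ⟨c, hc, hc'⟩ := exists_factor (S := Set.univ) hτ'.continuousOn hτ.continuousOn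
    (fun z _ => (hp' z).1.trans (hp z).1.symm) (fun z _ => (hp' z).2) (fun z _ => (hp z).2)
  obtain ⟨k, hk, hk'⟩ := exists_continuous_log_square (continuousOn_univ.1 hc) fun t => (hc' t trivial).1
  have hk2 : ∀ z, τ' z = fiberSMul (Complex.exp (k z)) (τ z) := fun z => by
    rw [hk']; exact (hc' z trivial).2
  have ea := exp_eq_one_const (k := fun t => a' t + k (0, t) - (k (1, t) + a t)) (by fun_prop) (by
    intro t
    have := h1' t
    rw [hk2, hk2, h1, fiberSMul_mul, fiberSMul_mul] at this
    have := fiberSMul_left_injective (hp _).2 this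
    rw [Complex.exp_sub, Complex.exp_add, Complex.exp_add, this,
      div_self (mul_ne_zero (Complex.exp_ne_zero _) (Complex.exp_ne_zero _))])
  have eb := exp_eq_one_const (k := fun t => b' t + k (t, 0) - (k (t, 1) + b t)) (by fun_prop) (by
    intro t
    have := h2' t
    rw [hk2, hk2, h2, fiberSMul_mul, fiberSMul_mul] at this
    have := fiberSMul_left_injective (hp _).2 this
    rw [Complex.exp_sub, Complex.exp_add, Complex.exp_add, this,
      div_self (mul_ne_zero (Complex.exp_ne_zero _) (Complex.exp_ne_zero _))])
  have e : (2 * Real.pi * Complex.I) * (d : ℂ) = (2 * Real.pi * Complex.I) * (d' : ℂ) := by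
    rw [← h3, ← h3']
    linear_combination ea - eb
  exact_mod_cast mul_left_cancel₀ Complex.two_pi_I_ne_zero e

/-- The degree of a complex line bundle over `T²`. -/
noncomputable def lineDegree : ℤ := (exists_isLineDegree E).choose

lemma isLineDegree_iff {d : ℤ} : IsLineDegree E d ↔ lineDegree E = d :=
  ⟨fun h => (exists_isLineDegree E).choose_spec.unique h,
    fun h => h ▸ (exists_isLineDegree E).choose_spec⟩

end Degree

/-! ### Finite group actions on line bundles over the torus -/

/-- `Γ` acts smoothly on the total space of the complex line bundle `E → T²` by complex vector
bundle automorphisms, lifting the smooth action of `Γ` on `T²` (which is thus the induced action):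
each `γ` maps the fibre over `x` to the fibre over `γ • x` by a complex linear map. -/
structure IsLineBundleAction (Γ : Type*) [Group Γ] (E : Torus → Type*)
    [∀ x, AddCommGroup (E x)] [∀ x, Module ℂ (E x)] [TopologicalSpace (TotalSpace ℂ E)]
    [∀ x, TopologicalSpace (E x)] [FiberBundle ℂ E] [VectorBundle ℂ ℂ E]
    [MulAction Γ Torus] [MulAction Γ (TotalSpace ℂ E)] : Prop where
  contMDiff_base : ∀ γ : Γ, ContMDiff torusModel torusModel ∞ fun x : Torus => γ • x
  contMDiff_total : ∀ γ : Γ, ContMDiff (torusModel.prod 𝓘(ℝ, ℂ)) (torusModel.prod 𝓘(ℝ, ℂ)) ∞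
    fun v : TotalSpace ℂ E => γ • v
  linear : ∀ (γ : Γ) (x : Torus), ∃ A : E x →ₗ[ℂ] E (γ • x),
    ∀ v : E x, γ • (⟨x, v⟩ : TotalSpace ℂ E) = ⟨γ • x, A v⟩

/-- The continuous self-map `x ↦ γ • x` of `T²` for a group element `γ` of a line bundle action. -/
def IsLineBundleAction.baseMap {Γ : Type*} [Group Γ] {E : Torus → Type*}
    [∀ x, AddCommGroup (E x)] [∀ x, Module ℂ (E x)] [TopologicalSpace (TotalSpace ℂ E)]
    [∀ x, TopologicalSpace (E x)] [FiberBundle ℂ E] [VectorBundle ℂ ℂ E]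
    [MulAction Γ Torus] [MulAction Γ (TotalSpace ℂ E)] (h : IsLineBundleAction Γ E) (γ : Γ) :
    C(Torus, Torus) :=
  ⟨fun x => γ • x, (h.contMDiff_base γ).continuous⟩

/-- The action of `Γ` on `X` factors through a free action of an abelian quotient `Γ ⧸ N` which can
be generated by two (not necessarily distinct) elements. -/
def FactorsThroughFreeTwoGeneratedAbelian (Γ X : Type*) [Group Γ] [MulAction Γ X] : Prop :=
  ∃ (N : Subgroup Γ) (_ : N.Normal) (φ : Γ ⧸ N →* Equiv.Perm X),
    (∀ (γ : Γ) (x : X), φ (γ : Γ ⧸ N) x = γ • x) ∧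
    (∀ (q : Γ ⧸ N) (x : X), φ q x = x → q = 1) ∧
    (∀ p q : Γ ⧸ N, p * q = q * p) ∧
    ∃ p q : Γ ⧸ N, Subgroup.closure {p, q} = ⊤

/-!
Lift each `γ ∈ Γ` to a diffeomorphism `A` of the plane. It satisfies `A (x + z) = A x + M z` for
`z ∈ ℤ²` with an integral matrix `M`, the action of `γ` on `π₁(T²)`, and `det M = 1` because `γ`
preserves the orientation. The matrices form a finite subgroup of `SL(2, ℤ)`, and such a group has
order at most `6` (`index_ker_specialLinearGroup_le`): it has a common eigenvector, so it embeds in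
`ℂˣ`, hence is cyclic, and the trace of a generator bounds its order. Let `H` be the subgroup of
those `γ` with `M = 1`; it has index at most `6`, and it is all of `Γ` if `Γ` acts trivially on
`H¹(T²; ℤ)`, because the winding cocycles of the two coordinates detect `M`.

The lifts of elements of `H` commute with each other (`commute_of_isTorusLift`). Indeed, the mean
displacement along an orbit of `Γ` is additive, so it vanishes on a commutator. As the commutator
has finite order modulo `ℤ²`, it has finite order. An orientation preserving map of finite order
that commutes with `ℤ²` is the identity (`IsPeriodicMap.eq_id_of_iterate_eq_id`): if it had prime
order `p`, the average `h` of its powers would be a map of degree one, but the map would permute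
each regular fibre of `h` without fixed points and preserve the signs of the Jacobian, so `p` would
divide the degree. The degree is computed with Stokes' theorem.

The pullback of the line bundle `E` to the plane has a global frame `σ`, and
`γ σ(x) = exp (F x) σ(A x)` with a continuous function `F`. For commuting lifts `A`, `B`
with logarithms `F`, `G` the function `G x + F (B x) - F x - G (A x)` is constant, because the
commutator has finite order. The constant `c` is biadditive and alternating, `exp c` is the
scalar by which the commutator acts, and
for the two generating translations `c = 2πi deg E` by the definition of the degree. If `n = |Γ|`,
then `Aⁿ` and `Bⁿ` are translations by vectors `z` and `w` of `ℤ²`, hence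
`c = 2πi deg E · det(z / n, w / n)` (`IsLogCommutator.card_sq_mul_eq`).

So `H` is abelian if `deg E = 0`. Otherwise take `B` to be an arbitrary lift and `A` the translation
by `(1, 0)`, which lifts the neutral element: the commutator is trivial, so `deg E` times the second
coordinate of `w / n` is an integer. Therefore this coordinate modulo `1` is a homomorphism on `H`
with at most `|deg E|` values. On its kernel the lifts can be chosen so that the second coordinates
of `z / n` and `w / n` vanish; then `c = 0`, and the kernel is abelian.
-/

/-! ### Lifts of self-maps of the torus to the plane -/

/-- The point of the lattice `ℤ² ⊆ ℝ²` with the given coordinates. -/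
def latticeVec : (Fin 2 → ℤ) →+ ℝ × ℝ where
  toFun z := (z 0, z 1)
  map_zero' := by simp
  map_add' z w := by simp

lemma latticeVec_apply (z : Fin 2 → ℤ) : latticeVec z = ((z 0 : ℝ), (z 1 : ℝ)) := rfl

lemma latticeVec_injective : Function.Injective latticeVec := by
  intro z w h
  simp only [latticeVec_apply, Prod.mk.injEq, Int.cast_inj] at h
  ext i
  fin_cases i
  · exact h.1
  · exact h.2

lemma torusCover_eq_iff {x y : ℝ × ℝ} :
    torusCover x = torusCover y ↔ ∃ z, x = y + latticeVec z := by
  have h2 : (2 * Real.pi) ≠ 0 := by positivity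
  simp only [torusCover, Prod.mk.injEq, Circle.exp_eq_exp]
  constructor
  · rintro ⟨⟨m, hm⟩, ⟨n, hn⟩⟩
    refine ⟨![m, n], Prod.ext ?_ ?_⟩
    · apply mul_left_cancel₀ h2
      simp only [latticeVec_apply, Prod.fst_add, Matrix.cons_val_zero]
      linear_combination hm
    · apply mul_left_cancel₀ h2
      simp only [latticeVec_apply, Prod.snd_add, Matrix.cons_val_one, Matrix.cons_val_zero]
      linear_combination hn
  · rintro ⟨z, rfl⟩
    refine ⟨⟨z 0, ?_⟩, ⟨z 1, ?_⟩⟩ <;> simp [latticeVec_apply] <;> ring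

lemma torusCover_add_latticeVec (x : ℝ × ℝ) (z : Fin 2 → ℤ) :
    torusCover (x + latticeVec z) = torusCover x :=
  torusCover_eq_iff.2 ⟨z, rfl⟩

lemma torusCover_surjective : Function.Surjective torusCover := by
  rintro ⟨u, v⟩
  refine ⟨(Complex.arg u / (2 * Real.pi), Complex.arg v / (2 * Real.pi)), ?_⟩
  have h2 : (2 * Real.pi) ≠ 0 := by positivity
  simp only [torusCover, mul_div_cancel₀ _ h2, Circle.exp_arg]

/-- Continuous integer-valued real functions on a preconnected space are constant. -/
lemma exists_int_of_continuous {X : Type*} [TopologicalSpace X] [PreconnectedSpace X] [Nonempty X]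
    {f : X → ℝ} (hf : Continuous f) (h : ∀ x, ∃ n : ℤ, f x = n) : ∃ n : ℤ, ∀ x, f x = n := by
  choose g hg using h
  have hgc : Continuous g := by
    rw [Int.isClosedEmbedding_coe_real.isEmbedding.continuous_iff]
    exact hf.congr hg
  obtain ⟨x₀⟩ := ‹Nonempty X›
  exact ⟨g x₀, fun x => by rw [hg, PreconnectedSpace.constant ‹_› hgc (x := x) (y := x₀)]⟩

lemma exists_latticeVec_of_continuous {X : Type*} [TopologicalSpace X] [PreconnectedSpace X]
    [Nonempty X] {f g : X → ℝ × ℝ} (hf : Continuous f) (hg : Continuous g)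
    (h : ∀ x, torusCover (f x) = torusCover (g x)) : ∃ z, ∀ x, f x = g x + latticeVec z := by
  have h' := fun x => torusCover_eq_iff.1 (h x)
  choose w hw using h'
  obtain ⟨m, hm⟩ := exists_int_of_continuous (f := fun x => (f x).1 - (g x).1) (by fun_prop)
    (fun x => ⟨w x 0, by rw [hw]; simp [latticeVec_apply]⟩)
  obtain ⟨n, hn⟩ := exists_int_of_continuous (f := fun x => (f x).2 - (g x).2) (by fun_prop)
    (fun x => ⟨w x 1, by rw [hw]; simp [latticeVec_apply]⟩)
  refine ⟨![m, n], fun x => Prod.ext ?_ ?_⟩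
  · simpa [latticeVec_apply, sub_eq_iff_eq_add'] using hm x
  · simpa [latticeVec_apply, sub_eq_iff_eq_add'] using hn x

/-- A map of a retract of a simply connected space to the circle has a continuous angle. -/
lemma exists_continuous_angle_of_retract {A Z : Type*} [TopologicalSpace A] [TopologicalSpace Z]
    [SimplyConnectedSpace A] [LocallyPathConnectedSpace A] {i : Z → A} {r : A → Z}
    (hi : Continuous i) (hr : Continuous r) (hri : ∀ z, r (i z) = z)
    {f : Z → Circle} (hf : Continuous f) :
    ∃ k : Z → ℝ, Continuous k ∧ ∀ x, Circle.exp (2 * Real.pi * k x) = f x := by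
  obtain ⟨k, hk, hk'⟩ := exists_continuous_log_of_retract hi hr hri
    (f := fun x => (f x : ℂ)) (by fun_prop) (fun x => Circle.coe_ne_zero _)
  refine ⟨fun x => (k x).im / (2 * Real.pi), by fun_prop, fun x => ?_⟩
  have h2 : (2 * Real.pi) ≠ 0 := by positivity
  rw [mul_div_cancel₀ _ h2]
  have hre : (k x).re = 0 := by
    have := congrArg norm (hk' x)
    rwa [Complex.norm_exp, Circle.norm_coe, Real.exp_eq_one_iff] at this
  ext
  rw [Circle.coe_exp, ← hk']
  congr 1
  apply Complex.ext <;> simp [hre]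

lemma exists_continuous_angle {f : ℝ × ℝ → Circle} (hf : Continuous f) :
    ∃ k : ℝ × ℝ → ℝ, Continuous k ∧ ∀ x, Circle.exp (2 * Real.pi * k x) = f x :=
  exists_continuous_angle_of_retract (i := id) (r := id) continuous_id continuous_id
    (fun _ => rfl) hf

/-- `A : ℝ² → ℝ²` is a lift of the self-map `f` of the torus to the universal covering. -/
structure IsTorusLift (f : Torus → Torus) (A : ℝ × ℝ → ℝ × ℝ) : Prop where
  continuous : Continuous A
  cover : ∀ x, torusCover (A x) = f (torusCover x)

lemma exists_isTorusLift {f : Torus → Torus} (hf : Continuous f) : ∃ A, IsTorusLift f A := by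
  have hc := hf.comp continuous_torusCover
  obtain ⟨k, hk, hk'⟩ := exists_continuous_angle (f := fun x => (f (torusCover x)).1)
    (continuous_fst.comp hc)
  obtain ⟨l, hl, hl'⟩ := exists_continuous_angle (f := fun x => (f (torusCover x)).2)
    (continuous_snd.comp hc)
  exact ⟨fun x => (k x, l x), by fun_prop, fun x => Prod.ext (hk' x) (hl' x)⟩

namespace IsTorusLift

variable {f g : Torus → Torus} {A B : ℝ × ℝ → ℝ × ℝ}

lemma comp (hA : IsTorusLift f A) (hB : IsTorusLift g B) : IsTorusLift (f ∘ g) (A ∘ B) :=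
  ⟨hA.continuous.comp hB.continuous, fun x => by simp [hA.cover, hB.cover]⟩

lemma add_latticeVec (hA : IsTorusLift f A) (z : Fin 2 → ℤ) :
    IsTorusLift f (fun x => A x + latticeVec z) :=
  ⟨hA.continuous.add continuous_const, fun x => by rw [torusCover_add_latticeVec, hA.cover]⟩

lemma exists_eq_add (hA : IsTorusLift f A) (hB : IsTorusLift f B) :
    ∃ z, ∀ x, B x = A x + latticeVec z :=
  exists_latticeVec_of_continuous hB.continuous hA.continuous
    fun x => by rw [hA.cover, hB.cover]

end IsTorusLift

/-- `M` is the matrix of the action on `ℤ² = π₁(T²)` of the self-map of the torus with lift `A`. -/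
def HasMonodromy (A : ℝ × ℝ → ℝ × ℝ) (M : Matrix (Fin 2) (Fin 2) ℤ) : Prop :=
  ∀ x z, A (x + latticeVec z) = A x + latticeVec (M.mulVec z)

namespace HasMonodromy

variable {A B : ℝ × ℝ → ℝ × ℝ} {M N : Matrix (Fin 2) (Fin 2) ℤ}

lemma comp (hA : HasMonodromy A M) (hB : HasMonodromy B N) : HasMonodromy (A ∘ B) (M * N) := by
  intro x z
  simp only [Function.comp_apply, hB x z, hA (B x), Matrix.mulVec_mulVec]

lemma add_const (hA : HasMonodromy A M) (v : ℝ × ℝ) : HasMonodromy (fun x => A x + v) M := by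
  intro x z
  simp only [hA x z]
  abel

lemma unique (hA : HasMonodromy A M) (hA' : HasMonodromy A N) : M = N := by
  apply Matrix.ext_of_mulVec_single
  intro i
  have h := (hA 0 (Pi.single i 1)).symm.trans (hA' 0 (Pi.single i 1))
  exact latticeVec_injective (add_left_cancel h)

end HasMonodromy

lemma hasMonodromy_id : HasMonodromy id 1 := by
  intro x z
  simp

lemma IsTorusLift.exists_hasMonodromy {f : Torus → Torus} {A : ℝ × ℝ → ℝ × ℝ}
    (hA : IsTorusLift f A) : ∃ M, HasMonodromy A M := by
  have h : ∀ z, ∃ w, ∀ x, A (x + latticeVec z) = A x + latticeVec w := fun z =>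
    exists_latticeVec_of_continuous (hA.continuous.comp (by fun_prop)) hA.continuous
      fun x => by rw [hA.cover, hA.cover, torusCover_add_latticeVec]
  choose w hw using h
  have hadd : ∀ z z', w (z + z') = w z + w z' := by
    intro z z'
    apply latticeVec_injective
    apply add_left_cancel (a := A 0)
    rw [← hw, map_add, map_add, ← add_assoc, ← add_assoc, hw, hw, add_assoc]
  let L : (Fin 2 → ℤ) →ₗ[ℤ] (Fin 2 → ℤ) := (AddMonoidHom.mk' w hadd).toIntLinearMap
  refine ⟨LinearMap.toMatrix' L, fun x z => ?_⟩
  rw [hw]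
  congr 2
  rw [LinearMap.toMatrix'_mulVec]
  rfl

lemma contDiff_of_contDiff_circleExp {k : ℝ × ℝ → ℝ} (hk : Continuous k)
    (h : ContDiff ℝ ∞ fun x => (Circle.exp (2 * Real.pi * k x) : ℂ)) : ContDiff ℝ ∞ k := by
  have h2 : (2 * Real.pi) ≠ 0 := by positivity
  rw [contDiff_iff_contDiffAt]
  intro x₀
  have hev : ∀ᶠ x in 𝓝 x₀, |2 * Real.pi * (k x - k x₀)| < Real.pi := by
    have hc : ContinuousAt (fun x => |2 * Real.pi * (k x - k x₀)|) x₀ := by fun_prop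
    exact hc.eventually_lt continuousAt_const (by simp [Real.pi_pos])
  have heq : k =ᶠ[𝓝 x₀] fun x => k x₀ + (Complex.log ((Circle.exp (2 * Real.pi * k x) : ℂ) *
      Complex.exp (-(2 * Real.pi * k x₀ * Complex.I)))).im / (2 * Real.pi) := by
    filter_upwards [hev] with x hx
    rw [abs_lt] at hx
    have e : (Circle.exp (2 * Real.pi * k x) : ℂ) * Complex.exp (-(2 * Real.pi * k x₀ * Complex.I))
        = Complex.exp ((2 * Real.pi * (k x - k x₀) : ℝ) * Complex.I) := by
      rw [Circle.coe_exp, ← Complex.exp_add]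
      congr 1
      push_cast
      ring
    rw [e, Complex.log_exp (by simpa using hx.1) (by simpa using hx.2.le), Complex.im_ofReal_mul,
      Complex.I_im]
    field_simp
    ring
  refine ContDiffAt.congr_of_eventuallyEq ?_ heq
  have hs : (Circle.exp (2 * Real.pi * k x₀) : ℂ) * Complex.exp (-(2 * Real.pi * k x₀ * Complex.I))
      = 1 := by
    rw [Circle.coe_exp, ← Complex.exp_add]
    simp
  have hlog : ContDiffAt ℝ ∞ Complex.log ((Circle.exp (2 * Real.pi * k x₀) : ℂ) *
      Complex.exp (-(2 * Real.pi * k x₀ * Complex.I))) := by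
    rw [hs]
    exact (Complex.contDiffAt_log Complex.one_mem_slitPlane).restrict_scalars ℝ
  have hc := hlog.comp x₀ ((h.mul (contDiff_const (c :=
    Complex.exp (-(2 * Real.pi * k x₀ * Complex.I))))).contDiffAt)
  exact contDiffAt_const.add ((Complex.imCLM.contDiff.contDiffAt.comp x₀ hc).div_const _)

lemma contMDiff_torusCover : ContMDiff 𝓘(ℝ, ℝ × ℝ) torusModel ∞ torusCover := by
  refine ContMDiff.prodMk ?_ ?_
  · exact contMDiff_circleExp.comp
      (ContDiff.contMDiff (f := fun z : ℝ × ℝ => 2 * Real.pi * z.1) (by fun_prop))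
  · exact contMDiff_circleExp.comp
      (ContDiff.contMDiff (f := fun z : ℝ × ℝ => 2 * Real.pi * z.2) (by fun_prop))

lemma contMDiff_coe_circle : ContMDiff (𝓡 1) 𝓘(ℝ, ℂ) ∞ (fun z : Circle => (z : ℂ)) := by
  have : Fact (Module.finrank ℝ ℂ = 1 + 1) := finrank_real_complex_fact'
  exact contMDiff_coe_sphere (E := ℂ) (n := 1)

namespace IsTorusLift

variable {f : Torus → Torus} {A : ℝ × ℝ → ℝ × ℝ}

lemma contDiff (hA : IsTorusLift f A) (hf : ContMDiff torusModel torusModel ∞ f) :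
    ContDiff ℝ ∞ A := by
  have h := hf.comp contMDiff_torusCover
  have h1 := (contMDiff_coe_circle.comp (contMDiff_fst.comp h)).contDiff
  have h2 := (contMDiff_coe_circle.comp (contMDiff_snd.comp h)).contDiff
  refine ContDiff.prodMk (f := fun x => (A x).1) (g := fun x => (A x).2) ?_ ?_
  · refine contDiff_of_contDiff_circleExp (continuous_fst.comp hA.continuous) ?_
    refine (congrArg (ContDiff ℝ ∞) (funext fun x => ?_)).mp h1
    simp only [Function.comp_apply, ← hA.cover]
    rfl
  · refine contDiff_of_contDiff_circleExp (continuous_snd.comp hA.continuous) ?_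
    refine (congrArg (ContDiff ℝ ∞) (funext fun x => ?_)).mp h2
    simp only [Function.comp_apply, ← hA.cover]
    rfl

lemma det_fderiv_pos (hA : IsTorusLift f A) (hf : TorusOrientationPreserving f) (x : ℝ × ℝ) :
    0 < (fderiv ℝ A x).det := by
  obtain ⟨F, hFx, hF, hFd, hdet⟩ := hf x (A x) (hA.cover x)
  suffices h : A =ᶠ[𝓝 x] F by rwa [h.fderiv_eq]
  have hc : ContinuousAt (fun z => ‖A z - F z‖) x :=
    (hA.continuous.continuousAt.sub hFd.continuousAt).norm
  have hev := hc.eventually_lt continuousAt_const (by simp [hFx] : _ < (1 : ℝ))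
  filter_upwards [hF, hev] with z hz hz1
  obtain ⟨w, hw⟩ := torusCover_eq_iff.1 (hz.trans (hA.cover z).symm)
  rw [hw, norm_sub_rev, add_sub_cancel_left, latticeVec_apply, Prod.norm_def, max_lt_iff] at hz1
  have h0 : w 0 = 0 := by
    rw [← Int.abs_lt_one_iff]
    have := hz1.1
    simp only [Real.norm_eq_abs] at this
    exact_mod_cast this
  have h1 : w 1 = 0 := by
    rw [← Int.abs_lt_one_iff]
    have := hz1.2
    simp only [Real.norm_eq_abs] at this
    exact_mod_cast this
  rw [hw, latticeVec_apply, h0, h1]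
  simp

end IsTorusLift

/-! ### Finite groups of integral matrices of determinant one -/

section FiniteSL2

/-- A root of modulus one of `X² - t X + 1` with integral `t` is a root of unity of order at most
`6`, because `|t| ≤ 2`. -/
lemma exists_pow_eq_one_of_norm_eq_one {l : ℂ} {t : ℤ} (hl : ‖l‖ = 1)
    (h : l ^ 2 - t * l + 1 = 0) : ∃ n, 0 < n ∧ n ≤ 6 ∧ l ^ n = 1 := by
  have hl0 : l ≠ 0 := by
    rintro rfl
    simp at hl
  have ht : |t| ≤ 2 := by
    have e : (t : ℂ) * l = l ^ 2 + 1 := by linear_combination -h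
    have := norm_add_le (l ^ 2) 1
    rw [← e, norm_mul, norm_pow, hl, norm_one, Complex.norm_intCast] at this
    have h3 : |(t : ℝ)| ≤ 2 := by linarith
    exact_mod_cast h3
  obtain ⟨h1, h2⟩ := abs_le.1 ht
  interval_cases t
  · refine ⟨2, by norm_num, by norm_num, ?_⟩
    have : (l + 1) ^ 2 = 0 := by push_cast at h; linear_combination h
    have := pow_eq_zero_iff (two_ne_zero) |>.1 this
    linear_combination (l - 1) * this
  · refine ⟨3, by norm_num, by norm_num, ?_⟩
    push_cast at h
    linear_combination (l - 1) * h
  · refine ⟨4, by norm_num, by norm_num, ?_⟩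
    push_cast at h
    linear_combination (l ^ 2 - 1) * h
  · refine ⟨6, by norm_num, by norm_num, ?_⟩
    push_cast at h
    linear_combination (l ^ 3 - 1) * (l + 1) * h
  · refine ⟨1, by norm_num, by norm_num, ?_⟩
    have : (l - 1) ^ 2 = 0 := by push_cast at h; linear_combination h
    have := pow_eq_zero_iff (two_ne_zero) |>.1 this
    linear_combination this

open Matrix in
/-- A finite group of integral matrices preserves a positive definite integral form
`a x² + 2 b x y + c y²`; as the determinant is one, `gᵀ B g = B` is linear in the entries of `g`. -/
lemma exists_invariant_form {G : Type*} [Group G] [Finite G]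
    (φ : G →* SpecialLinearGroup (Fin 2) ℤ) :
    ∃ a b c : ℤ, 0 < a ∧ 0 < a * c - b ^ 2 ∧ ∀ g, a * (φ g 1 1 - φ g 0 0) = 2 * b * φ g 1 0 ∧
      a * φ g 0 1 = -(φ g 1 0 * c) := by
  classical
  have := Fintype.ofFinite G
  let N : G → Matrix (Fin 2) (Fin 2) ℤ := fun g => (φ g : Matrix (Fin 2) (Fin 2) ℤ)
  have hN : ∀ g k, N (g * k) = N g * N k := fun g k => by simp [N]
  have hN1 : N 1 = 1 := by simp [N]
  let B : Matrix (Fin 2) (Fin 2) ℤ := ∑ g, (N g)ᵀ * N g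
  have hsymm : Bᵀ = B := by
    simp [B, transpose_sum, transpose_mul]
  have hinv : ∀ k, (N k)ᵀ * B * N k = B := by
    intro k
    simp only [B, Finset.mul_sum, Finset.sum_mul]
    refine Fintype.sum_equiv (Equiv.mulRight k) _ _ fun g => ?_
    simp [hN, transpose_mul, mul_assoc]
  have hpos : ∀ v : Fin 2 → ℤ, v ≠ 0 → 0 < v ⬝ᵥ (B *ᵥ v) := by
    intro v hv
    have e : v ⬝ᵥ (B *ᵥ v) = ∑ g, (N g *ᵥ v) ⬝ᵥ (N g *ᵥ v) := by
      simp only [B, sum_mulVec, dotProduct_sum]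
      refine Finset.sum_congr rfl fun g _ => ?_
      rw [← mulVec_mulVec, dotProduct_mulVec, vecMul_transpose]
    rw [e]
    refine Finset.sum_pos' (fun g _ => ?_) ⟨1, Finset.mem_univ _, ?_⟩
    · simp only [dotProduct, Fin.sum_univ_two]
      nlinarith [sq_nonneg ((N g *ᵥ v) 0), sq_nonneg ((N g *ᵥ v) 1)]
    · rw [hN1, one_mulVec]
      refine lt_of_le_of_ne ?_ fun h => hv (dotProduct_self_eq_zero.1 h.symm)
      simp only [dotProduct, Fin.sum_univ_two]
      nlinarith [sq_nonneg (v 0), sq_nonneg (v 1)]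
  have hb : B 1 0 = B 0 1 := congrFun (congrFun hsymm 0) 1
  have ha : 0 < B 0 0 := by
    have := hpos ![1, 0] (by simp)
    simpa [dotProduct, mulVec, Fin.sum_univ_two] using this
  refine ⟨B 0 0, B 0 1, B 1 1, ha, ?_, fun g => ?_⟩
  · have := hpos ![-B 0 1, B 0 0] (by simp [ha.ne'])
    simp only [dotProduct, mulVec, Fin.sum_univ_two, hb, cons_val_zero, cons_val_one] at this
    nlinarith
  · have hdet : N g 0 0 * N g 1 1 - N g 0 1 * N g 1 0 = 1 := by
      rw [← det_fin_two]
      exact (φ g).2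
    have hi := hinv g
    have h00 := congrFun (congrFun hi 0) 0
    have h01 := congrFun (congrFun hi 0) 1
    simp only [mul_apply, transpose_apply, Fin.sum_univ_two, hb] at h00 h01
    change B 0 0 * (N g 1 1 - N g 0 0) = 2 * B 0 1 * N g 1 0 ∧ B 0 0 * N g 0 1 = -(N g 1 0 * B 1 1)
    generalize N g 0 0 = p at *
    generalize N g 0 1 = q at *
    generalize N g 1 0 = r at *
    generalize N g 1 1 = s at *
    generalize B 0 0 = a at *
    generalize B 0 1 = b at *
    generalize B 1 1 = c at *
    constructor
    · linear_combination (-s) * h00 + r * h01 + (a * p + b * r) * hdet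
    · linear_combination (-q) * h00 + p * h01 - (b * p + c * r) * hdet

open Matrix in
/-- A finite group of integral matrices of determinant one has order at most `6`: its elements
commute with the complex structure of the invariant form and thus have a common eigenvector, the
eigenvalue gives a faithful character, so the group is cyclic, and its generator has order at
most `6`. -/
lemma index_ker_specialLinearGroup_le {G : Type*} [Group G] [Finite G]
    (φ : G →* SpecialLinearGroup (Fin 2) ℤ) : φ.ker.index ≤ 6 := by
  obtain ⟨a, b, c, ha, hD, hg⟩ := exists_invariant_form φ
  have ha0 : (a : ℂ) ≠ 0 := by exact_mod_cast ha.ne'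
  have hD' : (0 : ℝ) < a * c - b ^ 2 := by exact_mod_cast hD
  set d : ℝ := Real.sqrt (a * c - b ^ 2) with hd
  have hd0 : 0 < d := Real.sqrt_pos.2 hD'
  have hd2 : (d : ℂ) ^ 2 = a * c - b ^ 2 := by
    have := Real.sq_sqrt hD'.le
    rw [← hd] at this
    exact_mod_cast this
  -- `(w, -a)` is an isotropic vector of the form, hence the common eigenvector.
  obtain ⟨w, hw⟩ : ∃ w : ℂ, w = b + d * Complex.I := ⟨_, rfl⟩
  have hw2 : w ^ 2 = 2 * b * w - a * c := by
    rw [hw]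
    linear_combination (d : ℂ) ^ 2 * Complex.I_sq - hd2
  have hdet : ∀ g, (φ g 0 0 : ℂ) * φ g 1 1 - φ g 0 1 * φ g 1 0 = 1 := by
    intro g
    have := (φ g).2
    rw [det_fin_two] at this
    exact_mod_cast this
  let l : G → ℂ := fun g => φ g 1 1 - φ g 1 0 * w / a
  have hl2 : ∀ g, φ g 1 0 * w = (φ g 1 1 - l g) * a := by
    intro g
    simp only [l]
    field_simp
    ring
  have hone : l 1 = 1 := by simp [l]
  clear_value l
  have hl1 : ∀ g, φ g 0 0 * w - φ g 0 1 * a = l g * w := by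
    intro g
    obtain ⟨h1, h2⟩ := hg g
    have h1' : (a : ℂ) * (φ g 1 1 - φ g 0 0) = 2 * b * φ g 1 0 := by exact_mod_cast h1
    have h2' : (a : ℂ) * φ g 0 1 = -(φ g 1 0 * c) := by exact_mod_cast h2
    apply mul_left_cancel₀ ha0
    linear_combination (-w) * h1' - a * h2' - w * hl2 g + (φ g 1 0 : ℂ) * hw2
  have hmul : ∀ g k, l (g * k) = l g * l k := by
    intro g k
    have e1 : ((φ (g * k) 1 1 : ℤ) : ℂ) = φ g 1 0 * φ k 0 1 + φ g 1 1 * φ k 1 1 := by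
      simp [mul_apply, Fin.sum_univ_two]
    have e2 : ((φ (g * k) 1 0 : ℤ) : ℂ) = φ g 1 0 * φ k 0 0 + φ g 1 1 * φ k 1 0 := by
      simp [mul_apply, Fin.sum_univ_two]
    have := hl2 (g * k)
    rw [e1, e2] at this
    apply mul_left_cancel₀ ha0
    linear_combination this - (φ g 1 0 : ℂ) * hl1 k - l k * hl2 g
      - (φ g 1 1 : ℂ) * hl2 k
  have hquad : ∀ g, l g ^ 2 - (φ g 0 0 + φ g 1 1 : ℤ) * l g + 1 = 0 := by
    intro g
    apply mul_left_cancel₀ ha0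
    push_cast
    linear_combination (φ g 1 0 : ℂ) * hl1 g + (l g - φ g 0 0) * hl2 g - a * hdet g
  let χ : G →* ℂ := { toFun := l, map_one' := hone, map_mul' := hmul }
  let ψ : G →* ℂˣ := χ.toHomUnits
  have hψ : ∀ g, (ψ g : ℂ) = l g := fun g => rfl
  have hker : ψ.ker ≤ φ.ker := by
    intro g hgk
    have h1 : l g = 1 := by
      rw [← hψ, (MonoidHom.mem_ker).1 hgk]
      rfl
    have h2 := hl2 g
    rw [h1, hw] at h2
    have him := congrArg Complex.im h2
    have hre := congrArg Complex.re h2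
    simp at him hre
    have hr : φ g 1 0 = 0 := him.resolve_right hd0.ne'
    rw [hr] at hre
    simp only [Int.cast_zero, zero_mul, zero_eq_mul] at hre
    have hs : φ g 1 1 = 1 := by
      rcases hre with hre | hre
      · have : (φ g 1 1 : ℝ) = 1 := by linarith
        exact_mod_cast this
      · exact absurd (by exact_mod_cast hre) ha.ne'
    obtain ⟨h3, h4⟩ := hg g
    rw [hr] at h3 h4
    have hq : φ g 0 1 = 0 := by simpa [ha.ne'] using h4
    have hp : φ g 0 0 = 1 := by
      have : φ g 1 1 - φ g 0 0 = 0 := by simpa [ha.ne'] using h3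
      linarith
    rw [MonoidHom.mem_ker]
    ext i j
    fin_cases i <;> fin_cases j <;> simp [hr, hs, hq, hp]
  have hle := Subgroup.index_dvd_of_le hker
  have : Finite ψ.range := Set.finite_range ψ
  obtain ⟨⟨_, g, rfl⟩, hgen⟩ := IsCyclic.exists_generator (α := ψ.range)
  have hcard : Nat.card ψ.range = orderOf (ψ g) := by
    rw [← orderOf_eq_card_of_forall_mem_zpowers hgen]
    exact Subgroup.orderOf_mk _ _
  have hnorm : ‖l g‖ = 1 := by
    have hfin : IsOfFinOrder (l g) := by
      rw [← hψ]
      exact (Units.coeHom ℂ).isOfFinOrder (isOfFinOrder_of_finite g |> ψ.isOfFinOrder)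
    exact hfin.norm_eq_one
  obtain ⟨n, hn0, hn6, hn⟩ := exists_pow_eq_one_of_norm_eq_one hnorm (hquad g)
  have hord : orderOf (ψ g) ≤ 6 := by
    refine (orderOf_le_of_pow_eq_one hn0 ?_).trans hn6
    ext
    simpa [hψ] using hn
  refine (Nat.le_of_dvd ?_ hle).trans ?_
  · exact Nat.pos_of_ne_zero ψ.ker.index_ne_zero_of_finite
  · rwa [Subgroup.index_ker, hcard]

end FiniteSL2

/-! ### The degree formula for maps of the plane at bounded distance from the identity -/

section Degree

open MeasureTheory

lemma det_prod_eq (L : ℝ × ℝ →L[ℝ] ℝ × ℝ) :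
    L.det = (L (1, 0)).1 * (L (0, 1)).2 - (L (0, 1)).1 * (L (1, 0)).2 := by
  rw [ContinuousLinearMap.det, ← LinearMap.det_toMatrix (Module.Basis.finTwoProd ℝ),
    Matrix.det_fin_two]
  simp [LinearMap.toMatrix_apply]

/-- Stokes' theorem for `u dw` on a square: the Jacobian `du ∧ dw` of a map `(u, w)` to the unit
square that maps each side of the square to the corresponding side has integral one. -/
lemma integral_jacobian_eq_one {u w : ℝ × ℝ → ℝ} (hu : ContDiff ℝ 2 u) (hw : ContDiff ℝ 2 w)
    {R : ℝ} (hR : 0 ≤ R) (hu0 : ∀ t, u (-R, t) = 0) (hu1 : ∀ t, u (R, t) = 1)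
    (hw0 : ∀ s, w (s, -R) = 0) (hw1 : ∀ s, w (s, R) = 1) :
    ∫ x in Set.Icc (-R, -R) (R, R), (fderiv ℝ u x (1, 0) * fderiv ℝ w x (0, 1)
      - fderiv ℝ u x (0, 1) * fderiv ℝ w x (1, 0)) = 1 := by
  have hud : ∀ x, HasFDerivAt u (fderiv ℝ u x) x :=
    fun x => (hu.differentiable (by norm_num) x).hasFDerivAt
  have hwd : ∀ x, HasFDerivAt w (fderiv ℝ w x) x :=
    fun x => (hw.differentiable (by norm_num) x).hasFDerivAt
  have hDw : ContDiff ℝ 1 (fderiv ℝ w) := hw.fderiv_right (by norm_num)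
  have hDu : ContDiff ℝ 1 (fderiv ℝ u) := hu.fderiv_right (by norm_num)
  have hDDw : ∀ v x, HasFDerivAt (fun x => fderiv ℝ w x v) ((fderiv ℝ (fderiv ℝ w) x).flip v) x :=
    fun v x => by
      simpa using (hDw.differentiable (by norm_num) x).hasFDerivAt.clm_apply
        (hasFDerivAt_const v x)
  have hsymm : ∀ x v v', fderiv ℝ (fderiv ℝ w) x v v' = fderiv ℝ (fderiv ℝ w) x v' v := fun x =>
    hw.contDiffAt.isSymmSndFDerivAt (by simp)
  have hcDu : Continuous (fderiv ℝ u) := hDu.continuous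
  have hcDw : Continuous (fderiv ℝ w) := hDw.continuous
  have key := integral_divergence_prod_Icc_of_hasFDerivAt_of_le
    (fun x => u x * fderiv ℝ w x (0, 1)) (fun x => -(u x * fderiv ℝ w x (1, 0)))
    (fun x => u x • (fderiv ℝ (fderiv ℝ w) x).flip (0, 1) + fderiv ℝ w x (0, 1) • fderiv ℝ u x)
    (fun x => -(u x • (fderiv ℝ (fderiv ℝ w) x).flip (1, 0) + fderiv ℝ w x (1, 0) • fderiv ℝ u x))
    (-R, -R) (R, R) (by constructor <;> simp <;> linarith)
    (by have := hu.continuous; fun_prop)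
    (by have := hu.continuous; fun_prop)
    (fun x _ => (hud x).mul (hDDw _ x))
    (fun x _ => ((hud x).mul (hDDw _ x)).neg)
  have e : ∀ x, (u x • (fderiv ℝ (fderiv ℝ w) x).flip (0, 1)
        + fderiv ℝ w x (0, 1) • fderiv ℝ u x) (1, 0)
      + (-(u x • (fderiv ℝ (fderiv ℝ w) x).flip (1, 0)
        + fderiv ℝ w x (1, 0) • fderiv ℝ u x)) (0, 1)
      = fderiv ℝ u x (1, 0) * fderiv ℝ w x (0, 1) - fderiv ℝ u x (0, 1) * fderiv ℝ w x (1, 0) := by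
    intro x
    simp [hsymm x (1, 0) (0, 1)]
    ring
  simp only [e] at key
  rw [key (by
    apply Continuous.integrableOn_Icc
    fun_prop)]
  have hside : ∀ c : ℝ, (∀ s s', w (s, c) = w (s', c)) → ∀ s, fderiv ℝ w (s, c) (1, 0) = 0 := by
    intro c hc s
    have h1 : HasDerivAt (fun r : ℝ => w (r, c)) (fderiv ℝ w (s, c) (1, 0)) s :=
      (hwd (s, c)).comp_hasDerivAt s ((hasDerivAt_id s).prodMk (hasDerivAt_const s c))
    have h2 : (fun r : ℝ => w (r, c)) = fun _ => w (s, c) := funext fun r => hc r s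
    rw [h2] at h1
    exact h1.unique (hasDerivAt_const s _)
  have hint : ∫ y in (-R)..R, fderiv ℝ w (R, y) (0, 1) = 1 := by
    have h1 : ∀ y, HasDerivAt (fun r : ℝ => w (R, r)) (fderiv ℝ w (R, y) (0, 1)) y := fun y =>
      (hwd (R, y)).comp_hasDerivAt y ((hasDerivAt_const y R).prodMk (hasDerivAt_id y))
    rw [intervalIntegral.integral_eq_sub_of_hasDerivAt (fun y _ => h1 y)
      (by apply Continuous.intervalIntegrable; fun_prop), hw0, hw1, sub_zero]
  simp [hu0, hu1, hint, hside R (fun s s' => by rw [hw1, hw1]),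
    hside (-R) (fun s s' => by rw [hw0, hw0])]

/-- `Φ` is a smooth function that is `0` up to `a` and `1` from `b` on; its derivative is a bump
function of integral one. -/
structure IsTransition (Φ : ℝ → ℝ) (a b : ℝ) : Prop where
  contDiff : ContDiff ℝ 2 Φ
  monotone : Monotone Φ
  eq_zero : ∀ t ≤ a, Φ t = 0
  eq_one : ∀ t, b ≤ t → Φ t = 1

lemma exists_isTransition (a : ℝ) {ε : ℝ} (hε : 0 < ε) : ∃ Φ, IsTransition Φ (a - ε) (a + ε) := by
  refine ⟨fun t => Real.smoothTransition ((t - (a - ε)) / (2 * ε)), ?_, ?_, ?_, ?_⟩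
  · exact Real.smoothTransition.contDiff.comp (by fun_prop)
  · intro s t hst
    exact Real.smoothTransition.monotone (by gcongr)
  · intro t ht
    exact Real.smoothTransition.zero_of_nonpos
      (div_nonpos_of_nonpos_of_nonneg (by linarith) (by linarith))
  · intro t ht
    exact Real.smoothTransition.one_of_one_le ((one_le_div (by linarith)).2 (by linarith))

namespace IsTransition

variable {Φ Ψ : ℝ → ℝ} {a b a' b' : ℝ}

lemma hasDerivAt (h : IsTransition Φ a b) (t : ℝ) : HasDerivAt Φ (deriv Φ t) t :=
  (h.contDiff.differentiable (by norm_num) t).hasDerivAt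

lemma continuous_deriv (h : IsTransition Φ a b) : Continuous (deriv Φ) :=
  h.contDiff.continuous_deriv (by norm_num)

lemma deriv_nonneg (h : IsTransition Φ a b) (t : ℝ) : 0 ≤ deriv Φ t := h.monotone.deriv_nonneg

lemma deriv_eq_zero (h : IsTransition Φ a b) {t : ℝ} (ht : t ∉ Set.Icc a b) : deriv Φ t = 0 := by
  rw [Set.mem_Icc, not_and_or, not_le, not_le] at ht
  rcases ht with ht | ht
  · have : Φ =ᶠ[𝓝 t] fun _ => 0 := by
      filter_upwards [gt_mem_nhds ht] with s hs
      exact h.eq_zero s hs.le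
    rw [this.deriv_eq, deriv_const]
  · have : Φ =ᶠ[𝓝 t] fun _ => 1 := by
      filter_upwards [lt_mem_nhds ht] with s hs
      exact h.eq_one s hs.le
    rw [this.deriv_eq, deriv_const]

/-- The degree of a map of the plane at bounded distance from the identity is one. -/
lemma integral_mul_det_fderiv (hΦ : IsTransition Φ a b) (hΨ : IsTransition Ψ a' b')
    {h : ℝ × ℝ → ℝ × ℝ} (hh : ContDiff ℝ 2 h) {C : ℝ} (hC : ∀ x, ‖h x - x‖ ≤ C) :
    ∫ x, deriv Φ (h x).1 * deriv Ψ (h x).2 * (fderiv ℝ h x).det = 1 := by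
  have hC0 : 0 ≤ C := (norm_nonneg _).trans (hC 0)
  have hC1 : ∀ x, |(h x).1 - x.1| ≤ C := fun x => (norm_fst_le (h x - x)).trans (hC x)
  have hC2 : ∀ x, |(h x).2 - x.2| ≤ C := fun x => (norm_snd_le (h x - x)).trans (hC x)
  set R : ℝ := C + |a| + |b| + |a'| + |b'| with hR
  have := abs_nonneg a
  have := abs_nonneg b
  have := abs_nonneg a'
  have := abs_nonneg b'
  have := neg_abs_le a
  have := neg_abs_le a'
  have := le_abs_self b
  have := le_abs_self b'
  have hR0 : 0 ≤ R := by positivity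
  have hsupp : ∀ x ∉ Set.Icc (-R, -R) (R, R),
      deriv Φ (h x).1 * deriv Ψ (h x).2 * (fderiv ℝ h x).det = 0 := by
    intro x hx
    have h1 := abs_le.1 (hC1 x)
    have h2 := abs_le.1 (hC2 x)
    by_cases hx1 : x.1 ∈ Set.Icc (-R) R
    · rw [hΨ.deriv_eq_zero (t := (h x).2)]
      · ring
      · rintro ⟨h3, h4⟩
        exact hx ⟨⟨hx1.1, by simp; linarith⟩, ⟨hx1.2, by simp; linarith⟩⟩
    · rw [hΦ.deriv_eq_zero (t := (h x).1)]
      · ring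
      · rintro ⟨h3, h4⟩
        exact hx1 ⟨by linarith, by linarith⟩
  rw [← setIntegral_eq_integral_of_forall_compl_eq_zero hsupp]
  have hh1 : ContDiff ℝ 2 fun x => (h x).1 := hh.fst
  have hh2 : ContDiff ℝ 2 fun x => (h x).2 := hh.snd
  have hhd : ∀ x, HasFDerivAt h (fderiv ℝ h x) x :=
    fun x => (hh.differentiable (by norm_num) x).hasFDerivAt
  have key := integral_jacobian_eq_one (u := fun x => Φ (h x).1) (w := fun x => Ψ (h x).2)
    (hΦ.contDiff.comp hh1) (hΨ.contDiff.comp hh2) hR0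
    (fun t => hΦ.eq_zero _ (by have := abs_le.1 (hC1 (-R, t)); simp at this; linarith))
    (fun t => hΦ.eq_one _ (by have := abs_le.1 (hC1 (R, t)); simp at this; linarith))
    (fun t => hΨ.eq_zero _ (by have := abs_le.1 (hC2 (t, -R)); simp at this; linarith))
    (fun t => hΨ.eq_one _ (by have := abs_le.1 (hC2 (t, R)); simp at this; linarith))
  rw [← key]
  congr 1
  ext x
  have e1 : HasFDerivAt (fun x => Φ (h x).1) _ x :=
    (hΦ.hasDerivAt (h x).1).hasFDerivAt.comp x (hhd x).fst
  have e2 : HasFDerivAt (fun x => Ψ (h x).2) _ x :=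
    (hΨ.hasDerivAt (h x).2).hasFDerivAt.comp x (hhd x).snd
  rw [e1.fderiv, e2.fderiv, det_prod_eq]
  simp
  ring

end IsTransition

end Degree

/-! ### Torsion-freeness of the group of lifts -/

section Torsion

open MeasureTheory

/-- Local properties of a smooth map of the plane near a regular point. -/
lemma exists_nhds_of_det_ne_zero {h : ℝ × ℝ → ℝ × ℝ} (hh : ContDiff ℝ 2 h) {x : ℝ × ℝ}
    (hx : (fderiv ℝ h x).det ≠ 0) :
    𝓝 (h x) ≤ Filter.map h (𝓝 x) ∧ ∃ W, IsOpen W ∧ x ∈ W ∧ Set.InjOn h W ∧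
      ∀ z ∈ W, SignType.sign (fderiv ℝ h z).det = SignType.sign (fderiv ℝ h x).det := by
  have hs : HasStrictFDerivAt h
      ((fderiv ℝ h x).toContinuousLinearEquivOfDetNeZero hx : ℝ × ℝ →L[ℝ] ℝ × ℝ) x :=
    hh.contDiffAt.hasStrictFDerivAt (by norm_num)
  refine ⟨hs.map_nhds_eq_of_equiv.ge, ?_⟩
  have hcD : Continuous (fderiv ℝ h) := hh.continuous_fderiv (by norm_num)
  have hc : Continuous fun z => (fderiv ℝ h z).det := by
    simp only [det_prod_eq]
    fun_prop
  have hev : ∀ᶠ z in 𝓝 x, SignType.sign (fderiv ℝ h z).det = SignType.sign (fderiv ℝ h x).det := by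
    have h1 : ContinuousAt (fun z => SignType.sign (fderiv ℝ h z).det) x :=
      (continuousAt_sign_of_ne_zero hx).comp (f := fun z => (fderiv ℝ h z).det) hc.continuousAt
    exact h1.eventually (isOpen_discrete {SignType.sign (fderiv ℝ h x).det} |>.mem_nhds rfl)
  obtain ⟨V, hV, hVo, hxV⟩ := eventually_nhds_iff.1 hev
  let e := hs.toOpenPartialHomeomorph h
  refine ⟨V ∩ e.source, hVo.inter e.open_source,
    ⟨hxV, hs.mem_toOpenPartialHomeomorph_source⟩, ?_, fun z hz => hV z hz.1⟩
  exact e.injOn.mono Set.inter_subset_right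

/-- The degree counts preimages of a regular value with signs: for a map at bounded distance from
the identity, the signs of the Jacobian at the preimages add up to one. -/
lemma exists_fiber_sum_sign_eq_one {h : ℝ × ℝ → ℝ × ℝ} (hh : ContDiff ℝ 2 h) {C : ℝ}
    (hC : ∀ x, ‖h x - x‖ ≤ C) {y : ℝ × ℝ} (hy : ∀ x, h x = y → (fderiv ℝ h x).det ≠ 0) :
    ∃ F : Finset (ℝ × ℝ), (∀ x, x ∈ F ↔ h x = y) ∧
      ∑ x ∈ F, (SignType.sign (fderiv ℝ h x).det : ℝ) = 1 := by
  classical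
  have hhc : Continuous h := hh.continuous
  have hC0 : 0 ≤ C := (norm_nonneg _).trans (hC 0)
  have hK : ∀ x, ‖h x - y‖ ≤ 1 → x ∈ Metric.closedBall (0 : ℝ × ℝ) (‖y‖ + 1 + C) := by
    intro x hx
    rw [mem_closedBall_zero_iff]
    calc ‖x‖ = ‖y + (h x - y) - (h x - x)‖ := by congr 1; abel
      _ ≤ ‖y‖ + ‖h x - y‖ + ‖h x - x‖ := (norm_sub_le _ _).trans (by gcongr; exact norm_add_le _ _)
      _ ≤ ‖y‖ + 1 + C := by gcongr; exact hC x
  have hKc : IsCompact (Metric.closedBall (0 : ℝ × ℝ) (‖y‖ + 1 + C)) := isCompact_closedBall _ _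
  have hloc : ∀ x, ∃ W, h x = y → (𝓝 y ≤ Filter.map h (𝓝 x) ∧ IsOpen W ∧ x ∈ W ∧ Set.InjOn h W ∧
      ∀ z ∈ W, SignType.sign (fderiv ℝ h z).det = SignType.sign (fderiv ℝ h x).det) := by
    intro x
    by_cases hx : h x = y
    · obtain ⟨h1, W, h2⟩ := exists_nhds_of_det_ne_zero hh (hy x hx)
      exact ⟨W, fun _ => ⟨hx ▸ h1, h2⟩⟩
    · exact ⟨∅, fun h => absurd h hx⟩
  choose W hW using hloc
  have hfin : (h ⁻¹' {y}).Finite := by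
    have hcomp : IsCompact (h ⁻¹' {y}) :=
      hKc.of_isClosed_subset (isClosed_singleton.preimage hhc)
        fun x hx => hK x (by rw [show h x = y from hx]; simp)
    obtain ⟨t, ht, hcov⟩ := hcomp.elim_nhds_subcover W
      fun x hx => (hW x hx).2.1.mem_nhds (hW x hx).2.2.1
    refine t.finite_toSet.subset fun z hz => ?_
    obtain ⟨x, hxt, hzx⟩ := Set.mem_iUnion₂.1 (hcov hz)
    have hx := ht x hxt
    rw [(hW x hx).2.2.2.1 hzx (hW x hx).2.2.1 (Eq.trans hz (Eq.symm hx))]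
    exact hxt
  obtain ⟨U, hU, hUd⟩ := hfin.t2_separation
  set F := hfin.toFinset with hF
  have hFm : ∀ x, x ∈ F ↔ h x = y := fun x => by simp [hF]
  let V : ℝ × ℝ → Set (ℝ × ℝ) := fun x => U x ∩ W x
  have hVo : ∀ x ∈ F, IsOpen (V x) := fun x hx => (hU x).2.inter (hW x ((hFm x).1 hx)).2.1
  have hVm : ∀ x ∈ F, x ∈ V x := fun x hx => ⟨(hU x).1, (hW x ((hFm x).1 hx)).2.2.1⟩
  have hVd : Set.Pairwise (F : Set (ℝ × ℝ)) (Function.onFun Disjoint V) := by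
    intro a ha b hb hab
    exact (hUd (by simpa [hF] using ha) (by simpa [hF] using hb) hab).mono
      Set.inter_subset_left Set.inter_subset_left
  -- A small square around the regular value is evenly covered.
  have himg : ∀ x ∈ F, h '' V x ∈ 𝓝 y := fun x hx =>
    (hW x ((hFm x).1 hx)).1 (Filter.image_mem_map ((hVo x hx).mem_nhds (hVm x hx)))
  have hout : (h '' (Metric.closedBall (0 : ℝ × ℝ) (‖y‖ + 1 + C) \ ⋃ x ∈ F, V x))ᶜ ∈ 𝓝 y := by
    have hc : IsCompact (Metric.closedBall (0 : ℝ × ℝ) (‖y‖ + 1 + C) \ ⋃ x ∈ F, V x) :=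
      hKc.diff (isOpen_biUnion hVo)
    refine (hc.image hhc).isClosed.isOpen_compl.mem_nhds ?_
    rintro ⟨x, ⟨-, hx⟩, hxy⟩
    exact hx (Set.mem_biUnion ((hFm x).2 hxy) (hVm x ((hFm x).2 hxy)))
  obtain ⟨ε', hε', hball⟩ := Metric.nhds_basis_closedBall.mem_iff.1
    (Filter.inter_mem ((Filter.biInter_finset_mem F).2 himg) hout)
  set ε := min ε' 1 with hεdef
  have hε : 0 < ε := lt_min hε' one_pos
  have hball1 : ∀ z, ‖z - y‖ ≤ ε → (∀ x ∈ F, z ∈ h '' V x) ∧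
      z ∉ h '' (Metric.closedBall (0 : ℝ × ℝ) (‖y‖ + 1 + C) \ ⋃ x ∈ F, V x) := by
    intro z hz
    have := hball (mem_closedBall_iff_norm.2 (hz.trans (min_le_left _ _)))
    exact ⟨fun x hx => Set.mem_iInter₂.1 this.1 x hx, this.2⟩
  have hball2 : ∀ x, ‖h x - y‖ ≤ ε → x ∈ ⋃ x ∈ F, V x := by
    intro x hx
    by_contra hcon
    exact (hball1 _ hx).2 ⟨x, ⟨hK x (hx.trans (min_le_right _ _)), hcon⟩, rfl⟩
  obtain ⟨Φ, hΦ⟩ := exists_isTransition y.1 hε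
  obtain ⟨Ψ, hΨ⟩ := exists_isTransition y.2 hε
  let f : ℝ × ℝ → ℝ := fun z => deriv Φ z.1 * deriv Ψ z.2
  have hfs : ∀ z, ¬ ‖z - y‖ ≤ ε → f z = 0 := by
    intro z hz
    rw [Prod.norm_def, max_le_iff, not_and_or] at hz
    rcases hz with hz | hz
    · simp only [f]
      rw [hΦ.deriv_eq_zero, zero_mul]
      rintro ⟨h1, h2⟩
      exact hz (abs_le.2 ⟨by simp; linarith, by simp; linarith⟩)
    · simp only [f]
      rw [hΨ.deriv_eq_zero, mul_zero]
      rintro ⟨h1, h2⟩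
      exact hz (abs_le.2 ⟨by simp; linarith, by simp; linarith⟩)
  have hfc : Continuous f := by
    have h1 := hΦ.continuous_deriv
    have h2 := hΨ.continuous_deriv
    fun_prop
  have hf1 : ∫ z, f z = 1 := by
    have := hΦ.integral_mul_det_fderiv hΨ (h := id) contDiff_id (C := 0) (by simp)
    simpa [f, ContinuousLinearMap.det] using this
  have hcD : Continuous (fderiv ℝ h) := hh.continuous_fderiv (by norm_num)
  have hdc : Continuous fun z => (fderiv ℝ h z).det := by
    simp only [det_prod_eq]
    fun_prop
  have hint : Integrable fun x => f (h x) * (fderiv ℝ h x).det := by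
    apply Continuous.integrable_of_hasCompactSupport (by fun_prop)
    refine HasCompactSupport.intro hKc fun x hx => ?_
    rw [hfs _ fun h => hx (hK x (h.trans (min_le_right _ _))), zero_mul]
  have htot : ∫ x, f (h x) * (fderiv ℝ h x).det = 1 := hΦ.integral_mul_det_fderiv hΨ hh hC
  rw [← setIntegral_eq_integral_of_forall_compl_eq_zero (s := ⋃ x ∈ F, V x) fun x hx => by
      rw [hfs _ fun h => hx (hball2 x h), zero_mul],
    integral_biUnion_finset F (fun x hx => (hVo x hx).measurableSet) hVd
      fun _ _ => hint.integrableOn] at htot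
  refine ⟨F, hFm, ?_⟩
  rw [← htot]
  refine Finset.sum_congr rfl fun x hx => ?_
  obtain ⟨-, -, -, hinj, hsign⟩ := hW x ((hFm x).1 hx)
  have hchange := integral_image_eq_integral_abs_det_fderiv_smul volume (hVo x hx).measurableSet
    (fun z _ => ((hh.differentiable (by norm_num) z).hasFDerivAt).hasFDerivWithinAt)
    (hinj.mono Set.inter_subset_right) f
  rw [setIntegral_eq_integral_of_forall_compl_eq_zero fun z hz => hfs z fun hz' =>
    hz ((hball1 z hz').1 x hx), hf1] at hchange
  calc (SignType.sign (fderiv ℝ h x).det : ℝ)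
      = ∫ z in V x, (SignType.sign (fderiv ℝ h x).det : ℝ) * (|(fderiv ℝ h z).det| • f (h z)) := by
        rw [integral_const_mul, ← hchange, mul_one]
    _ = _ := by
        refine setIntegral_congr_fun (hVo x hx).measurableSet fun z hz => ?_
        simp only [smul_eq_mul]
        rw [← hsign z hz.2, ← mul_assoc, sign_mul_abs, mul_comm]

lemma exists_regular_value {h : ℝ × ℝ → ℝ × ℝ} (hh : ContDiff ℝ 2 h) :
    ∃ y, ∀ x, h x = y → (fderiv ℝ h x).det ≠ 0 := by
  have h0 := addHaar_image_eq_zero_of_det_fderivWithin_eq_zero volume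
    (s := {x | (fderiv ℝ h x).det = 0})
    (fun x _ => ((hh.differentiable (by norm_num) x).hasFDerivAt).hasFDerivWithinAt)
    (fun x hx => hx)
  by_contra! hcon
  have : h '' {x | (fderiv ℝ h x).det = 0} = Set.univ := by
    ext y
    obtain ⟨x, hx, hx'⟩ := hcon y
    exact ⟨fun _ => trivial, fun _ => ⟨x, hx', hx⟩⟩
  rw [this] at h0
  simp at h0

lemma exists_norm_sub_le_of_hasMonodromy_one {g : ℝ × ℝ → ℝ × ℝ} (hg : Continuous g)
    (hm : HasMonodromy g 1) : ∃ C, ∀ x, ‖g x - x‖ ≤ C := by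
  have hc : Continuous fun x => g x - x := by fun_prop
  obtain ⟨C, hC⟩ := (isCompact_Icc (a := ((0 : ℝ), (0 : ℝ)))
    (b := (1, 1))).exists_bound_of_continuousOn hc.continuousOn
  refine ⟨C, fun x => ?_⟩
  have e : x = (Int.fract x.1, Int.fract x.2) + latticeVec ![⌊x.1⌋, ⌊x.2⌋] := by
    simp [latticeVec_apply]
  rw [e, hm, Matrix.one_mulVec, add_sub_add_right_eq_sub]
  exact hC _ ⟨⟨Int.fract_nonneg _, Int.fract_nonneg _⟩,
    ⟨(Int.fract_lt_one _).le, (Int.fract_lt_one _).le⟩⟩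

/-- A function on a finite set with values `±1` that is invariant under a fixed point free
transformation of prime order `p` has sum divisible by `p`. -/
lemma prime_dvd_sum_sign {α : Type*} {p : ℕ} (hp : p.Prime) {T : α → α} (hT : T^[p] = id)
    (F : Finset α) (hF : ∀ x ∈ F, T x ∈ F) (hfree : ∀ x ∈ F, T x ≠ x) (s : α → SignType)
    (hs : ∀ x ∈ F, s (T x) = s x) : (p : ℤ) ∣ ∑ x ∈ F, (s x : ℤ) := by
  classical
  have : Fact p.Prime := ⟨hp⟩
  have key : ∀ σ : SignType, p ∣ (F.filter fun x => s x = σ).card := by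
    intro σ
    let f : Function.End {x // x ∈ F.filter fun x => s x = σ} := fun x => ⟨T x.1, by
      have := Finset.mem_filter.1 x.2
      exact Finset.mem_filter.2 ⟨hF _ this.1, (hs _ this.1).trans this.2⟩⟩
    have hit : ∀ n x, ((f ^ n) x).1 = T^[n] x.1 := by
      intro n
      induction n with
      | zero => intro x; rfl
      | succ n ih =>
        intro x
        rw [pow_succ, Function.iterate_succ_apply]
        exact ih (f x)
    have hf : f ^ p ^ 1 = 1 := by
      funext x
      apply Subtype.ext
      rw [pow_one, hit, hT]
      rfl
    have hcard := Equiv.Perm.card_fixedPoints_modEq hf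
    have hempty : IsEmpty f.fixedPoints := by
      refine ⟨fun x => hfree x.1.1 (Finset.mem_filter.1 x.1.2).1 ?_⟩
      exact congrArg Subtype.val x.2
    rw [Fintype.card_eq_zero (α := f.fixedPoints), Fintype.card_coe] at hcard
    exact (Nat.modEq_zero_iff_dvd).1 hcard
  have hsum : ∑ x ∈ F, (s x : ℤ) = ∑ σ : SignType, ((F.filter fun x => s x = σ).card : ℤ) * σ := by
    rw [← Finset.sum_fiberwise F s]
    refine Finset.sum_congr rfl fun σ _ => ?_
    rw [Finset.sum_congr rfl fun x hx => by rw [(Finset.mem_filter.1 hx).2], Finset.sum_const,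
      nsmul_eq_mul]
  rw [hsum]
  exact Finset.dvd_sum fun σ _ => Dvd.dvd.mul_right (by exact_mod_cast key σ) _

/-- Smooth orientation preserving self-maps of the plane that commute with the translations by
`ℤ²`. -/
structure IsPeriodicMap (A : ℝ × ℝ → ℝ × ℝ) : Prop where
  contDiff : ContDiff ℝ ∞ A
  det_pos : ∀ x, 0 < (fderiv ℝ A x).det
  monodromy : HasMonodromy A 1

lemma det_comp (L L' : ℝ × ℝ →L[ℝ] ℝ × ℝ) : (L.comp L').det = L.det * L'.det := by
  simp [ContinuousLinearMap.det, LinearMap.det_comp]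

namespace IsPeriodicMap

variable {A B : ℝ × ℝ → ℝ × ℝ}

lemma hasFDerivAt (hA : IsPeriodicMap A) (x : ℝ × ℝ) : HasFDerivAt A (fderiv ℝ A x) x :=
  (hA.contDiff.differentiable (by norm_num) x).hasFDerivAt

lemma id : IsPeriodicMap id := ⟨contDiff_id, by simp [ContinuousLinearMap.det], hasMonodromy_id⟩

lemma comp (hA : IsPeriodicMap A) (hB : IsPeriodicMap B) : IsPeriodicMap (A ∘ B) where
  contDiff := hA.contDiff.comp hB.contDiff
  det_pos x := by
    rw [((hA.hasFDerivAt (B x)).comp x (hB.hasFDerivAt x)).fderiv, det_comp]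
    exact mul_pos (hA.det_pos _) (hB.det_pos _)
  monodromy := by simpa using hA.monodromy.comp hB.monodromy

lemma iterate (hA : IsPeriodicMap A) (n : ℕ) : IsPeriodicMap A^[n] := by
  induction n with
  | zero => exact IsPeriodicMap.id
  | succ n ih => exact ih.comp hA

/-- The average of a periodic transformation of prime order over the group it generates. -/
noncomputable def average (p : ℕ) (A : ℝ × ℝ → ℝ × ℝ) (x : ℝ × ℝ) : ℝ × ℝ :=
  (p : ℝ)⁻¹ • ∑ i ∈ Finset.range p, A^[i] x

lemma average_apply {p : ℕ} (hA : A^[p] = _root_.id) (x : ℝ × ℝ) :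
    average p A (A x) = average p A x := by
  unfold average
  congr 1
  have h1 := Finset.sum_range_succ' (fun i => A^[i] x) p
  rw [Finset.sum_range_succ, hA] at h1
  simpa using h1.symm

lemma contDiff_average (hA : IsPeriodicMap A) (p : ℕ) : ContDiff ℝ 2 (average p A) := by
  unfold average
  refine ContDiff.const_smul (p : ℝ)⁻¹ (ContDiff.sum (f := fun i x => A^[i] x) fun i _ => ?_)
  exact (hA.iterate i).contDiff.of_le (by norm_cast)

lemma hasMonodromy_average (hA : IsPeriodicMap A) {p : ℕ} (hp : p ≠ 0) :
    HasMonodromy (average p A) 1 := by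
  intro x z
  have hp' : (p : ℝ) ≠ 0 := by exact_mod_cast hp
  simp only [average, (hA.iterate _).monodromy x z, Finset.sum_add_distrib, smul_add,
    Matrix.one_mulVec]
  rw [Finset.sum_const, Finset.card_range, ← Nat.cast_smul_eq_nsmul ℝ, inv_smul_smul₀ hp']

/-- A transformation of finite order is the identity near a fixed point that is a regular point of
its average, because the average is locally injective there. Its derivative is the identity on the
closure of the set near whose points it is the identity, so these are regular points as well. Hence
a nontrivial transformation has no such fixed point. -/
lemma ne_of_det_average_ne_zero (hA : IsPeriodicMap A) {p : ℕ} (hp : p ≠ 0)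
    (hAp : A^[p] = _root_.id) (hne : A ≠ _root_.id) {x : ℝ × ℝ}
    (hx : (fderiv ℝ (average p A) x).det ≠ 0) : A x ≠ x := by
  have hloc : ∀ x, A x = x → (fderiv ℝ (average p A) x).det ≠ 0 → A =ᶠ[𝓝 x] _root_.id := by
    intro x hfix hx
    obtain ⟨-, W, hWo, hxW, hinj, -⟩ := exists_nhds_of_det_ne_zero (hA.contDiff_average p) hx
    have h1 : ∀ᶠ z in 𝓝 x, A z ∈ W :=
      hA.contDiff.continuous.continuousAt.eventually_mem (by rw [hfix]; exact hWo.mem_nhds hxW)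
    filter_upwards [h1, hWo.mem_nhds hxW] with z hz hz'
    exact hinj hz hz' (average_apply hAp z)
  intro hfix
  apply hne
  set U := {x | A =ᶠ[𝓝 x] _root_.id} with hU
  have hUo : IsOpen U := isOpen_setOfPred_eventually_nhds
  have hUc : IsClosed U := by
    rw [← closure_subset_iff_isClosed]
    intro z hz
    have hcD : Continuous (fderiv ℝ A) := hA.contDiff.continuous_fderiv (by norm_num)
    have hz1 : A z = z := by
      have : IsClosed {x | A x = x} := isClosed_eq hA.contDiff.continuous continuous_id
      exact this.closure_subset_iff.2 (fun y hy => hy.self_of_nhds) hz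
    have hz2 : fderiv ℝ A z = ContinuousLinearMap.id ℝ (ℝ × ℝ) := by
      have : IsClosed {x | fderiv ℝ A x = ContinuousLinearMap.id ℝ (ℝ × ℝ)} :=
        isClosed_eq hcD continuous_const
      refine this.closure_subset_iff.2 (fun y hy => ?_) hz
      exact hy.fderiv_eq.trans fderiv_id
    have hd := hA.hasFDerivAt z
    rw [hz2] at hd
    have hav : HasFDerivAt (average p A) ((p : ℝ)⁻¹ •
        ∑ i ∈ Finset.range p, (ContinuousLinearMap.id ℝ (ℝ × ℝ)) ^ i) z :=
      (HasFDerivAt.fun_sum fun i _ => hd.iterate hz1 i).fun_const_smul _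
    have hp' : (p : ℝ) ≠ 0 := by exact_mod_cast hp
    have e : (p : ℝ)⁻¹ • ∑ i ∈ Finset.range p, (ContinuousLinearMap.id ℝ (ℝ × ℝ)) ^ i
        = ContinuousLinearMap.id ℝ (ℝ × ℝ) := by
      have : ∀ i, (ContinuousLinearMap.id ℝ (ℝ × ℝ)) ^ i = ContinuousLinearMap.id ℝ (ℝ × ℝ) :=
        fun i => one_pow i
      simp only [this]
      rw [Finset.sum_const, Finset.card_range, ← Nat.cast_smul_eq_nsmul ℝ, inv_smul_smul₀ hp']
    refine hloc z hz1 ?_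
    rw [hav.fderiv, e]
    simp [ContinuousLinearMap.det]
  have huniv := IsClopen.eq_univ ⟨hUc, hUo⟩ ⟨x, hloc x hfix hx⟩
  funext z
  have : z ∈ U := huniv ▸ Set.mem_univ z
  exact this.self_of_nhds

lemma eq_id_of_iterate_prime_eq_id (hA : IsPeriodicMap A) {p : ℕ} (hp : p.Prime)
    (hAp : A^[p] = _root_.id) : A = _root_.id := by
  by_contra hne
  set h := average p A with hdef
  have hh : ContDiff ℝ 2 h := hA.contDiff_average p
  have hhA : ∀ x, h (A x) = h x := average_apply hAp
  obtain ⟨C, hC⟩ := exists_norm_sub_le_of_hasMonodromy_one hh.continuous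
    (hA.hasMonodromy_average hp.ne_zero)
  obtain ⟨y, hy⟩ := exists_regular_value hh
  obtain ⟨F, hF, hsum⟩ := exists_fiber_sum_sign_eq_one hh hC hy
  have hdvd := prime_dvd_sum_sign hp hAp F (fun x hx => (hF _).2 ((hhA x).trans ((hF x).1 hx)))
    (fun x hx => hA.ne_of_det_average_ne_zero hp.ne_zero hAp hne (hy x ((hF x).1 hx)))
    (fun x => SignType.sign (fderiv ℝ h x).det) (fun x _ => by
      have h1 : HasFDerivAt (h ∘ A) _ x :=
        (hh.differentiable (by norm_num) (A x)).hasFDerivAt.comp x (hA.hasFDerivAt x)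
      rw [show h ∘ A = h from funext hhA] at h1
      rw [h1.fderiv, det_comp, sign_mul, sign_pos (hA.det_pos x), mul_one])
  have hsum' : ∑ x ∈ F, ((SignType.sign (fderiv ℝ h x).det : SignType) : ℤ) = 1 := by
    have : ((∑ x ∈ F, ((SignType.sign (fderiv ℝ h x).det : SignType) : ℤ) : ℤ) : ℝ) = 1 := by
      rw [← hsum]
      push_cast
      simp
    exact_mod_cast this
  rw [hsum'] at hdvd
  exact hp.one_lt.ne' (by exact_mod_cast Int.eq_one_of_dvd_one (by positivity) hdvd)

/-- The group of periodic maps is torsion-free. -/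
lemma eq_id_of_iterate_eq_id {n : ℕ} (hn : 0 < n) :
    ∀ {A}, IsPeriodicMap A → A^[n] = _root_.id → A = _root_.id := by
  induction n using induction_on_primes with
  | zero => exact absurd hn (lt_irrefl 0)
  | one => exact fun _ h => h
  | prime_mul p a hp ih =>
    intro A hA h
    refine hA.eq_id_of_iterate_prime_eq_id hp (ih (Nat.pos_of_mul_pos_left hn) (hA.iterate p) ?_)
    rw [← Function.iterate_mul, h]

end IsPeriodicMap

end Torsion

/-! ### Logarithmic multipliers of a line bundle action -/

section Multipliers

lemma ne_zero_iff_ne_fiberSMul_zero {B : Type*} {E : B → Type*} [∀ x, AddCommGroup (E x)]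
    [∀ x, Module ℂ (E x)] {v : TotalSpace ℂ E} :
    v.2 ≠ 0 ↔ v ≠ fiberSMul 0 v := by
  obtain ⟨b, v⟩ := v
  simp [fiberSMul]

lemma fiberSMul_one {B : Type*} {E : B → Type*} [∀ x, AddCommGroup (E x)]
    [∀ x, Module ℂ (E x)] (v : TotalSpace ℂ E) :
    fiberSMul 1 v = v := by
  simp [fiberSMul]

section Section

variable {B : Type*} [TopologicalSpace B] {E : B → Type*}
  [∀ x, AddCommGroup (E x)] [∀ x, Module ℂ (E x)] [TopologicalSpace (TotalSpace ℂ E)]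
  [∀ x, TopologicalSpace (E x)] [FiberBundle ℂ E] [VectorBundle ℂ ℂ E]

lemma exists_eq_fiberSMul {u v : TotalSpace ℂ E} (h : v.proj = u.proj) (hu : u.2 ≠ 0) :
    ∃ c, v = fiberSMul c u := by
  obtain ⟨b, u⟩ := u
  obtain ⟨b', v⟩ := v
  obtain rfl : b' = b := h
  have hb : b' ∈ (trivializationAt ℂ E b').baseSet := FiberBundle.mem_baseSet_trivializationAt' b'
  set e := trivializationAt ℂ E b'
  have h2 : (e ⟨b', u⟩).2 ≠ 0 := trivialization_ne_zero e hb hu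
  refine ⟨(e ⟨b', v⟩).2 / (e ⟨b', u⟩).2, ?_⟩
  simp only [fiberSMul, TotalSpace.mk_inj]
  apply (e.linearEquivAt ℂ b' hb).injective
  rw [map_smul]
  simp only [Trivialization.linearEquivAt_apply, smul_eq_mul]
  field_simp

/-- Line bundles over a bounded square in the plane are trivial. -/
lemma hasSectionOn_closedBall {g : ℝ × ℝ → B} (hg : Continuous g) {R : ℝ} (hR : 0 < R) :
    HasSectionOn E g (Metric.closedBall 0 R) := by
  obtain ⟨τ, hτ, hτ'⟩ := hasSectionOn_square (E := E)
    (g := fun z : unitInterval × unitInterval => g (2 * R * z.1 - R, 2 * R * z.2 - R))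
    (by fun_prop)
  rw [continuousOn_univ] at hτ
  let r : ℝ → unitInterval := fun x => Set.projIcc 0 1 zero_le_one ((x + R) / (2 * R))
  have hr : Continuous r := continuous_projIcc.comp (by fun_prop)
  have hr' : ∀ x : ℝ, |x| ≤ R → 2 * R * (r x : ℝ) - R = x := by
    intro x hx
    obtain ⟨h1, h2⟩ := abs_le.1 hx
    simp only [r]
    rw [Set.projIcc_of_mem zero_le_one (x := (x + R) / (2 * R))
      ⟨by apply div_nonneg <;> linarith, by rw [div_le_one (by linarith)]; linarith⟩]
    field_simp
    ring
  refine ⟨fun x => τ (r x.1, r x.2), (by fun_prop : Continuous _).continuousOn, fun x hx => ?_⟩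
  rw [mem_closedBall_zero_iff, Prod.norm_def, max_le_iff] at hx
  have := hτ' (r x.1, r x.2) trivial
  simp only [hr' _ hx.1, hr' _ hx.2] at this
  exact this

/-- Line bundles over the plane are trivial. -/
lemma hasSectionOn_plane {g : ℝ × ℝ → B} (hg : Continuous g) : HasSectionOn E g Set.univ := by
  let S : ℕ → Set (ℝ × ℝ) := fun n => Metric.closedBall 0 (n + 1)
  let P : ℕ → (ℝ × ℝ → TotalSpace ℂ E) → Prop := fun n τ =>
    ContinuousOn τ (S n) ∧ ∀ z ∈ S n, (τ z).proj = g z ∧ (τ z).2 ≠ 0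
  have hS : ∀ n, HasSectionOn E g (S n) := fun n => hasSectionOn_closedBall hg (by positivity)
  have hmono : ∀ n, S n ⊆ S (n + 1) := fun n =>
    Metric.closedBall_subset_closedBall (by push_cast; linarith)
  have hext : ∀ n τ, P n τ → ∃ τ', P (n + 1) τ' ∧ ∀ z ∈ S n, τ' z = τ z := by
    rintro n τ ⟨hτ, hτ'⟩
    obtain ⟨υ, hυ, hυ'⟩ := hS (n + 1)
    obtain ⟨c, hc, hc'⟩ := exists_factor hτ (hυ.mono (hmono n))
      (fun z hz => (hτ' z hz).1.trans (hυ' z (hmono n hz)).1.symm)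
      (fun z hz => (hτ' z hz).2) (fun z hz => (hυ' z (hmono n hz)).2)
    have hn : (0 : ℝ) ≤ n + 1 := by positivity
    have hn' : (-(n + 1) : ℝ) ≤ n + 1 := by linarith
    let r : ℝ × ℝ → ℝ × ℝ := fun z => (Set.projIcc _ _ hn' z.1, Set.projIcc _ _ hn' z.2)
    have hrc : Continuous r := by
      have : Continuous (Set.projIcc _ _ hn') := continuous_projIcc
      fun_prop
    have hrS : ∀ z, r z ∈ S n := by
      intro z
      rw [mem_closedBall_zero_iff, Prod.norm_def, max_le_iff]
      exact ⟨abs_le.2 (Set.projIcc _ _ hn' z.1).2, abs_le.2 (Set.projIcc _ _ hn' z.2).2⟩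
    have hrid : ∀ z ∈ S n, r z = z := by
      intro z hz
      rw [mem_closedBall_zero_iff, Prod.norm_def, max_le_iff] at hz
      exact Prod.ext (by simp only [r, Set.projIcc_of_mem hn' (abs_le.1 hz.1)])
        (by simp only [r, Set.projIcc_of_mem hn' (abs_le.1 hz.2)])
    refine ⟨fun z => fiberSMul (c (r z)) (υ z), ⟨?_, ?_⟩, ?_⟩
    · exact continuousOn_fiberSMul hυ (hc.comp hrc.continuousOn fun z _ => hrS z)
    · exact fun z hz => ⟨(hυ' z hz).1, smul_ne_zero (hc' _ (hrS z)).1 (hυ' z hz).2⟩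
    · intro z hz
      change fiberSMul (c (r z)) (υ z) = τ z
      rw [hrid z hz, (hc' z hz).2]
  choose! ext hext using hext
  obtain ⟨τ₀, hτ₀⟩ := hS 0
  let τ : ℕ → ℝ × ℝ → TotalSpace ℂ E := fun n => Nat.rec τ₀ (fun n τ => ext n τ) n
  have hτ : ∀ n, P n (τ n) := by
    intro n
    induction n with
    | zero => exact hτ₀
    | succ n ih => exact (hext n _ ih).1
  have hτ' : ∀ n m, n ≤ m → ∀ z ∈ S n, τ m z = τ n z := by
    intro n m hnm
    induction hnm with
    | refl => exact fun z _ => rfl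
    | @step m hnm ih =>
      intro z hz
      rw [← ih z hz]
      refine (hext m _ (hτ m)).2 z (Metric.closedBall_subset_closedBall ?_ hz)
      exact_mod_cast Nat.succ_le_succ hnm
  have hceil : ∀ z, z ∈ S ⌈‖z‖⌉₊ := fun z => by
    rw [mem_closedBall_zero_iff]
    linarith [Nat.le_ceil ‖z‖]
  refine ⟨fun z => τ ⌈‖z‖⌉₊ z, ?_, fun z _ => (hτ _).2 z (hceil z)⟩
  rw [continuousOn_univ, continuous_iff_continuousAt]
  intro x
  have hx : S ⌈‖x‖⌉₊ ∈ 𝓝 x := by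
    refine Filter.mem_of_superset (Metric.isOpen_ball.mem_nhds ?_) Metric.ball_subset_closedBall
    rw [mem_ball_zero_iff]
    linarith [Nat.le_ceil ‖x‖]
  refine ((hτ ⌈‖x‖⌉₊).1.continuousAt hx).congr ?_
  filter_upwards [hx] with z hz
  rcases le_total ⌈‖x‖⌉₊ ⌈‖z‖⌉₊ with h | h
  · exact (hτ' _ _ h z hz).symm
  · exact hτ' _ _ h z (hceil z)

end Section

/-- A continuous logarithm of the constant function one on a connected space is constant. -/
lemma exists_eq_of_exp_eq_one {X : Type*} [TopologicalSpace X] [PreconnectedSpace X] [Nonempty X]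
    {k : X → ℂ} (hk : Continuous k) (h : ∀ x, Complex.exp (k x) = 1) : ∃ c, ∀ x, k x = c := by
  obtain ⟨x₀⟩ := ‹Nonempty X›
  have h1 := Complex.isCoveringMap_exp.eq_of_comp_eq (g₁ := k) (g₂ := fun _ => k x₀) hk
    continuous_const (by ext x; simp [h]) x₀ rfl
  exact ⟨k x₀, congrFun h1⟩

section Action

variable {E : Torus → Type*}
  [∀ x, AddCommGroup (E x)] [∀ x, Module ℂ (E x)] [TopologicalSpace (TotalSpace ℂ E)]
  [∀ x, TopologicalSpace (E x)] [FiberBundle ℂ E] [VectorBundle ℂ ℂ E]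
  {Γ : Type*} [Group Γ] [MulAction Γ Torus] [MulAction Γ (TotalSpace ℂ E)]

namespace IsLineBundleAction

lemma proj_smul (hΓ : IsLineBundleAction Γ E) (γ : Γ) (v : TotalSpace ℂ E) :
    (γ • v).proj = γ • v.proj := by
  obtain ⟨A, hA⟩ := hΓ.linear γ v.proj
  exact congrArg TotalSpace.proj (hA v.2)

lemma smul_fiberSMul (hΓ : IsLineBundleAction Γ E) (γ : Γ) (c : ℂ) (v : TotalSpace ℂ E) :
    γ • fiberSMul c v = fiberSMul c (γ • v) := by
  obtain ⟨A, hA⟩ := hΓ.linear γ v.proj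
  have h1 : γ • v = ⟨γ • v.proj, A v.2⟩ := hA v.2
  have h2 : γ • fiberSMul c v = ⟨γ • v.proj, A (c • v.2)⟩ := hA (c • v.2)
  rw [h1, h2, map_smul]
  rfl

lemma smul_snd_ne_zero (hΓ : IsLineBundleAction Γ E) (γ : Γ) {v : TotalSpace ℂ E}
    (hv : v.2 ≠ 0) : (γ • v).2 ≠ 0 := by
  rw [ne_zero_iff_ne_fiberSMul_zero] at hv ⊢
  intro h
  rw [← hΓ.smul_fiberSMul] at h
  exact hv (smul_left_cancel γ h)

end IsLineBundleAction

/-- A global frame of the pullback of the line bundle to the plane. -/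
structure IsPlaneFrame (σ : ℝ × ℝ → TotalSpace ℂ E) : Prop where
  continuous : Continuous σ
  proj : ∀ x, (σ x).proj = torusCover x
  ne_zero : ∀ x, (σ x).2 ≠ 0

variable (E) in
lemma exists_isPlaneFrame : ∃ σ : ℝ × ℝ → TotalSpace ℂ E, IsPlaneFrame σ := by
  obtain ⟨σ, hσ, hσ'⟩ := hasSectionOn_plane (E := E) continuous_torusCover
  exact ⟨σ, continuousOn_univ.1 hσ, fun x => (hσ' x trivial).1, fun x => (hσ' x trivial).2⟩

/-- With respect to the frame `σ` over the plane, the lift of `γ` to the pulled back bundle that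
covers `A` is multiplication by `exp F`. -/
structure IsLogLift (σ : ℝ × ℝ → TotalSpace ℂ E) (γ : Γ) (A : ℝ × ℝ → ℝ × ℝ) (F : ℝ × ℝ → ℂ) :
    Prop where
  continuous_base : Continuous A
  continuous_log : Continuous F
  smul_eq : ∀ x, γ • σ x = fiberSMul (Complex.exp (F x)) (σ (A x))

variable {σ : ℝ × ℝ → TotalSpace ℂ E} {γ γ' : Γ} {A B : ℝ × ℝ → ℝ × ℝ} {F F' G : ℝ × ℝ → ℂ}

lemma IsLineBundleAction.exists_isLogLift (hΓ : IsLineBundleAction Γ E) (hσ : IsPlaneFrame σ)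
    (hA : IsTorusLift (fun x => γ • x) A) : ∃ F, IsLogLift σ γ A F := by
  obtain ⟨c, hc, hc'⟩ := exists_factor (S := Set.univ) (f := fun x => γ • σ x)
    (g := fun x => σ (A x)) ((hΓ.contMDiff_total γ).continuous.comp hσ.continuous).continuousOn
    (hσ.continuous.comp hA.continuous).continuousOn
    (fun x _ => by rw [hΓ.proj_smul, hσ.proj, hσ.proj, hA.cover])
    (fun x _ => hΓ.smul_snd_ne_zero γ (hσ.ne_zero x)) (fun x _ => hσ.ne_zero _)
  obtain ⟨F, hF, hF'⟩ := exists_continuous_log_of_retract (A := ℝ × ℝ) (i := id) (r := id)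
    continuous_id continuous_id (fun _ => rfl) (continuousOn_univ.1 hc) fun x => (hc' x trivial).1
  exact ⟨F, hA.continuous, hF, fun x => by rw [hF']; exact (hc' x trivial).2⟩

namespace IsLogLift

lemma comp (hΓ : IsLineBundleAction Γ E) (hA : IsLogLift σ γ A F) (hB : IsLogLift σ γ' B G) :
    IsLogLift σ (γ * γ') (A ∘ B) (fun x => G x + F (B x)) where
  continuous_base := hA.continuous_base.comp hB.continuous_base
  continuous_log := hB.continuous_log.add (hA.continuous_log.comp hB.continuous_base)
  smul_eq x := by
    rw [mul_smul, hB.smul_eq, hΓ.smul_fiberSMul, hA.smul_eq, fiberSMul_mul, Complex.exp_add]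
    rfl

set_option linter.unusedSectionVars false in
lemma exists_eq_add (hσ : IsPlaneFrame σ) (h : IsLogLift σ γ A F) (h' : IsLogLift σ γ A F') :
    ∃ c, ∀ x, F' x = F x + c := by
  have hF := h.continuous_log
  have hF' := h'.continuous_log
  obtain ⟨c, hc⟩ := exists_eq_of_exp_eq_one (k := fun x => F' x - F x) (by fun_prop) fun x => by
    have := fiberSMul_left_injective (hσ.ne_zero _) ((h'.smul_eq x).symm.trans (h.smul_eq x))
    rw [Complex.exp_sub, this, div_self (Complex.exp_ne_zero _)]
  exact ⟨c, fun x => by rw [← hc x]; ring⟩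

end IsLogLift

/-- `c` is a logarithm of the commutator of the lifts of `γ` and `γ'` to the pulled back bundle
that cover the commuting maps `A` and `B`. -/
def IsLogCommutator (σ : ℝ × ℝ → TotalSpace ℂ E) (γ : Γ) (A : ℝ × ℝ → ℝ × ℝ) (γ' : Γ)
    (B : ℝ × ℝ → ℝ × ℝ) (c : ℂ) : Prop :=
  ∃ F G, IsLogLift σ γ A F ∧ IsLogLift σ γ' B G ∧ ∀ x, G x + F (B x) - (F x + G (A x)) = c

namespace IsLogCommutator

variable {c c' : ℂ} {γ'' : Γ} {A' : ℝ × ℝ → ℝ × ℝ}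

lemma unique (hσ : IsPlaneFrame σ) (h : IsLogCommutator σ γ A γ' B c)
    (h' : IsLogCommutator σ γ A γ' B c') : c = c' := by
  obtain ⟨F, G, hF, hG, hc⟩ := h
  obtain ⟨F', G', hF', hG', hc'⟩ := h'
  obtain ⟨a, ha⟩ := hF.exists_eq_add hσ hF'
  obtain ⟨b, hb⟩ := hG.exists_eq_add hσ hG'
  rw [← hc 0, ← hc' 0, ha, ha, hb, hb]
  ring

set_option linter.unusedSectionVars false in
lemma symm (h : IsLogCommutator σ γ A γ' B c) : IsLogCommutator σ γ' B γ A (-c) := by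
  obtain ⟨F, G, hF, hG, hc⟩ := h
  exact ⟨G, F, hG, hF, fun x => by rw [← hc x]; ring⟩

lemma mul_left (hΓ : IsLineBundleAction Γ E) (hσ : IsPlaneFrame σ)
    (hAB : ∀ x, A (B x) = B (A x))
    (h : IsLogCommutator σ γ A γ' B c) (h' : IsLogCommutator σ γ'' A' γ' B c') :
    IsLogCommutator σ (γ'' * γ) (A' ∘ A) γ' B (c' + c) := by
  obtain ⟨F, G, hF, hG, hc⟩ := h
  obtain ⟨F', G', hF', hG', hc'⟩ := h'
  obtain ⟨b, hb⟩ := hG.exists_eq_add hσ hG'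
  refine ⟨_, G, hF'.comp hΓ hF, hG, fun x => ?_⟩
  rw [← hc x, ← hc' (A x), hb, hb, hAB]
  simp only [Function.comp_apply]
  ring

lemma pow_left (hΓ : IsLineBundleAction Γ E) (hσ : IsPlaneFrame σ)
    (hAB : ∀ x, A (B x) = B (A x)) (h : IsLogCommutator σ γ A γ' B c) (n : ℕ) :
    IsLogCommutator σ (γ ^ n) A^[n] γ' B (n * c) := by
  induction n with
  | zero =>
    obtain ⟨-, G, -, hG, -⟩ := h
    exact ⟨fun _ => 0, G, ⟨continuous_id, continuous_const, fun x => by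
      simp [fiberSMul_one]⟩, hG, fun x => by simp⟩
  | succ n ih =>
    have := mul_left hΓ hσ hAB h ih
    rw [← pow_succ, ← Function.iterate_succ] at this
    convert this using 1
    push_cast
    ring

end IsLogCommutator

lemma IsLineBundleAction.eq_of_smul_frame_eq [FaithfulSMul Γ (TotalSpace ℂ E)]
    (hΓ : IsLineBundleAction Γ E) (hσ : IsPlaneFrame σ) (h : ∀ x, γ • σ x = γ' • σ x) :
    γ = γ' := by
  apply eq_of_smul_eq_smul (α := TotalSpace ℂ E)
  intro v
  obtain ⟨x, hx⟩ := torusCover_surjective v.proj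
  obtain ⟨c, rfl⟩ := exists_eq_fiberSMul (u := σ x) (v := v) (by rw [hσ.proj, hx]) (hσ.ne_zero x)
  rw [hΓ.smul_fiberSMul, hΓ.smul_fiberSMul, h]

/-- Lifts of commuting maps of the plane have a commutator that acts by a scalar. It is constant
because it has finite order at each point. -/
lemma IsLineBundleAction.exists_isLogCommutator [Finite Γ] (hΓ : IsLineBundleAction Γ E)
    (hσ : IsPlaneFrame σ) (hA : IsTorusLift (fun x => γ • x) A)
    (hB : IsTorusLift (fun x => γ' • x) B) (hAB : ∀ x, A (B x) = B (A x)) :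
    ∃ c, IsLogCommutator σ γ A γ' B c := by
  obtain ⟨F, hF⟩ := hΓ.exists_isLogLift hσ hA
  obtain ⟨G, hG⟩ := hΓ.exists_isLogLift hσ hB
  have h1 := (hF.comp hΓ hG).smul_eq
  have h2 := (hG.comp hΓ hF).smul_eq
  have hFc := hF.continuous_log
  have hGc := hG.continuous_log
  have hAc := hF.continuous_base
  have hBc := hG.continuous_base
  have hn : (Nat.card Γ : ℂ) ≠ 0 := by exact_mod_cast Nat.card_pos.ne'
  obtain ⟨c, hc⟩ := exists_eq_of_exp_eq_one
    (k := fun x => Nat.card Γ * (G x + F (B x) - (F x + G (A x)))) (by fun_prop) fun x => by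
      set v := (γ' * γ) • σ x with hv
      have hv0 : v.2 ≠ 0 := hΓ.smul_snd_ne_zero _ (hσ.ne_zero x)
      have hν : (γ * γ' * (γ' * γ)⁻¹) • v
          = fiberSMul (Complex.exp (G x + F (B x) - (F x + G (A x)))) v := by
        rw [hv, smul_smul, inv_mul_cancel_right, h1, h2, fiberSMul_mul, ← Complex.exp_add,
          sub_add_cancel]
        simp only [Function.comp_apply, hAB]
      have hpow : ∀ n : ℕ, (γ * γ' * (γ' * γ)⁻¹) ^ n • v
          = fiberSMul (Complex.exp (G x + F (B x) - (F x + G (A x))) ^ n) v := by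
        intro n
        induction n with
        | zero => simp [fiberSMul_one]
        | succ n ih =>
          rw [pow_succ, mul_smul, hν, hΓ.smul_fiberSMul, ih, fiberSMul_mul, ← pow_succ']
      have := hpow (Nat.card Γ)
      rw [pow_card_eq_one', one_smul] at this
      rw [Complex.exp_nat_mul]
      exact fiberSMul_left_injective hv0 (this.symm.trans (fiberSMul_one v).symm)
  refine ⟨c / Nat.card Γ, F, G, hF, hG, fun x => ?_⟩
  rw [← hc x]
  field_simp

lemma IsLogCommutator.exp_eq_one_iff [FaithfulSMul Γ (TotalSpace ℂ E)]
    (hΓ : IsLineBundleAction Γ E) (hσ : IsPlaneFrame σ) (hAB : ∀ x, A (B x) = B (A x)) {c : ℂ}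
    (h : IsLogCommutator σ γ A γ' B c) : Complex.exp c = 1 ↔ γ * γ' = γ' * γ := by
  obtain ⟨F, G, hF, hG, hc⟩ := h
  have h1 := (hF.comp hΓ hG).smul_eq
  have h2 := (hG.comp hΓ hF).smul_eq
  have key : ∀ x, (γ * γ') • σ x = fiberSMul (Complex.exp c) ((γ' * γ) • σ x) := by
    intro x
    rw [h1, h2, fiberSMul_mul, ← Complex.exp_add, ← hc x, sub_add_cancel]
    simp only [Function.comp_apply, hAB]
  constructor
  · intro h
    exact hΓ.eq_of_smul_frame_eq hσ fun x => by rw [key, h, fiberSMul_one]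
  · intro h
    have := key 0
    rw [h] at this
    exact (fiberSMul_left_injective (hΓ.smul_snd_ne_zero _ (hσ.ne_zero 0))
      ((fiberSMul_one _).trans this)).symm

/-- Translation of the plane by a lattice vector. -/
def deck (z : Fin 2 → ℤ) (x : ℝ × ℝ) : ℝ × ℝ := x + latticeVec z

lemma isTorusLift_deck (z : Fin 2 → ℤ) : IsTorusLift (fun x => (1 : Γ) • x) (deck z) where
  continuous := by unfold deck; fun_prop
  cover x := by rw [one_smul]; exact torusCover_add_latticeVec x z

lemma deck_comp (z w : Fin 2 → ℤ) : deck z ∘ deck w = deck (z + w) := by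
  funext x
  simp only [deck, Function.comp_apply, map_add]
  abel

/-- The degree in terms of the commutator of the two generating translations. -/
lemma isLogCommutator_deck_single (hσ : IsPlaneFrame σ) [Finite Γ] [FaithfulSMul Γ (TotalSpace ℂ E)]
    (hΓ : IsLineBundleAction Γ E) :
    IsLogCommutator σ (1 : Γ) (deck (Pi.single 0 1)) (1 : Γ) (deck (Pi.single 1 1))
      (2 * Real.pi * Complex.I * lineDegree E) := by
  have hAB : ∀ x, deck (Pi.single 0 1) (deck (Pi.single 1 1) x)
      = deck (Pi.single 1 1) (deck (Pi.single 0 1) x) := fun x => add_right_comm _ _ _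
  obtain ⟨c, hc⟩ := hΓ.exists_isLogCommutator hσ (isTorusLift_deck (Γ := Γ) (Pi.single 0 1))
    (isTorusLift_deck (Γ := Γ) (Pi.single 1 1)) hAB
  obtain ⟨m, hm⟩ := Complex.exp_eq_one_iff.1 ((hc.exp_eq_one_iff hΓ hσ hAB).2 rfl)
  suffices hdeg : IsLineDegree E m by
    rw [(isLineDegree_iff E).1 hdeg]
    convert hc using 1
    rw [hm]
    ring
  obtain ⟨F, G, hF, hG, hFG⟩ := hc
  have hFc := hF.continuous_log
  have hGc := hG.continuous_log
  have hσc := hσ.continuous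
  have e0 : ∀ x : ℝ × ℝ, deck (Pi.single 0 1) x = (x.1 + 1, x.2) := fun x => by
    simp [deck, latticeVec_apply, Prod.ext_iff]
  have e1 : ∀ x : ℝ × ℝ, deck (Pi.single 1 1) x = (x.1, x.2 + 1) := fun x => by
    simp [deck, latticeVec_apply, Prod.ext_iff]
  have hinv : ∀ (H : ℝ × ℝ → ℂ) (T : ℝ × ℝ → ℝ × ℝ), IsLogLift σ (1 : Γ) T H →
      ∀ x, σ (T x) = fiberSMul (Complex.exp (-H x)) (σ x) := by
    intro H T hH x
    have := hH.smul_eq x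
    rw [one_smul] at this
    rw [this, fiberSMul_mul, ← Complex.exp_add, neg_add_cancel, Complex.exp_zero, fiberSMul_one]
  refine ⟨fun z => σ (z.1, z.2), fun t => -F (0, t), fun s => -G (s, 0), by fun_prop, by fun_prop,
    by fun_prop, fun z => ⟨hσ.proj _, hσ.ne_zero _⟩, fun t => ?_, fun s => ?_, ?_⟩
  · have := hinv F _ hF (0, t)
    rw [e0] at this
    simpa using this
  · have := hinv G _ hG (s, 0)
    rw [e1] at this
    simpa using this
  · have := hFG 0
    rw [e0, e1, hm] at this
    simp only [Prod.fst_zero, Prod.snd_zero, zero_add] at this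
    simp only [Set.Icc.coe_one, Set.Icc.coe_zero]
    rw [← Prod.mk_zero_zero] at this
    linear_combination this

lemma addMonoidHom_apply_eq (f : (Fin 2 → ℤ) →+ ℂ) (z : Fin 2 → ℤ) :
    f z = z 0 * f (Pi.single 0 1) + z 1 * f (Pi.single 1 1) := by
  have hz : z = z 0 • Pi.single 0 1 + z 1 • Pi.single 1 1 := by
    ext i
    fin_cases i <;> simp
  conv_lhs => rw [hz]
  rw [map_add, map_zsmul, map_zsmul]
  simp

/-- The commutator with a translation is additive in the translation. -/
lemma exists_addMonoidHom_isLogCommutator [Finite Γ] (hΓ : IsLineBundleAction Γ E)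
    (hσ : IsPlaneFrame σ) (hB : IsTorusLift (fun x => γ' • x) B) (hB1 : HasMonodromy B 1) :
    ∃ f : (Fin 2 → ℤ) →+ ℂ, ∀ z, IsLogCommutator σ (1 : Γ) (deck z) γ' B (f z) := by
  have hcomm : ∀ z x, deck z (B x) = B (deck z x) := fun z x => by
    rw [deck, deck, hB1, Matrix.one_mulVec]
  have h := fun z => hΓ.exists_isLogCommutator hσ (isTorusLift_deck (Γ := Γ) z) hB (hcomm z)
  choose f hf using h
  refine ⟨AddMonoidHom.mk' f fun z w => ?_, hf⟩
  have := (hf w).mul_left hΓ hσ (hcomm w) (hf z)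
  rw [deck_comp, one_mul] at this
  exact (hf (z + w)).unique hσ this

lemma IsLogCommutator.deck_deck [Finite Γ] [FaithfulSMul Γ (TotalSpace ℂ E)]
    (hΓ : IsLineBundleAction Γ E) (hσ : IsPlaneFrame σ) {z w : Fin 2 → ℤ} {c : ℂ}
    (h : IsLogCommutator σ (1 : Γ) (deck z) (1 : Γ) (deck w) c) :
    c = 2 * Real.pi * Complex.I * lineDegree E * (z 0 * w 1 - z 1 * w 0) := by
  have hmono : ∀ w, HasMonodromy (deck w) 1 := fun w => hasMonodromy_id.add_const (latticeVec w)
  have hself : ∀ u c, IsLogCommutator σ (1 : Γ) (deck u) (1 : Γ) (deck u) c → c = 0 := by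
    intro u c hc
    have := hc.unique hσ hc.symm
    linear_combination this / 2
  obtain ⟨f, hf⟩ := exists_addMonoidHom_isLogCommutator hΓ hσ
    (isTorusLift_deck (Γ := Γ) w) (hmono w)
  obtain ⟨f0, hf0⟩ := exists_addMonoidHom_isLogCommutator hΓ hσ
    (isTorusLift_deck (Γ := Γ) (Pi.single 0 1)) (hmono _)
  obtain ⟨f1, hf1⟩ := exists_addMonoidHom_isLogCommutator hΓ hσ
    (isTorusLift_deck (Γ := Γ) (Pi.single 1 1)) (hmono _)
  have h01 := (hf1 (Pi.single 0 1)).unique hσ (isLogCommutator_deck_single hσ hΓ)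
  have h10 := (hf0 (Pi.single 1 1)).unique hσ (isLogCommutator_deck_single hσ hΓ).symm
  have h00 := hself _ _ (hf0 (Pi.single 0 1))
  have h11 := hself _ _ (hf1 (Pi.single 1 1))
  have e0 := (hf (Pi.single 0 1)).unique hσ (hf0 w).symm
  have e1 := (hf (Pi.single 1 1)).unique hσ (hf1 w).symm
  rw [addMonoidHom_apply_eq f0, h00, h10] at e0
  rw [addMonoidHom_apply_eq f1, h01, h11] at e1
  rw [h.unique hσ (hf z), addMonoidHom_apply_eq f, e0, e1]
  ring

/-- The commutator of two lifts in terms of their rotation vectors `z / n` and `w / n`, where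
`n = |Γ|`: it is the area of the parallelogram they span, times the degree. -/
lemma IsLogCommutator.card_sq_mul_eq [Finite Γ] [FaithfulSMul Γ (TotalSpace ℂ E)]
    (hΓ : IsLineBundleAction Γ E) (hσ : IsPlaneFrame σ) (hAB : ∀ x, A (B x) = B (A x))
    {z w : Fin 2 → ℤ} (hz : A^[Nat.card Γ] = deck z) (hw : B^[Nat.card Γ] = deck w) {c : ℂ}
    (h : IsLogCommutator σ γ A γ' B c) :
    (Nat.card Γ : ℂ) ^ 2 * c
      = 2 * Real.pi * Complex.I * lineDegree E * (z 0 * w 1 - z 1 * w 0) := by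
  have hAB' : Function.Commute A B := hAB
  have h1 := h.pow_left hΓ hσ hAB (Nat.card Γ)
  rw [pow_card_eq_one', hz] at h1
  have hzB : ∀ x, B (deck z x) = deck z (B x) := fun x => by
    rw [← hz]
    exact ((hAB'.iterate_left _).eq x).symm
  have h2 := (h1.symm.pow_left hΓ hσ hzB (Nat.card Γ)).symm
  rw [pow_card_eq_one', hw] at h2
  have h3 := h2.deck_deck hΓ hσ
  rw [← h3]
  ring

end Action

end Multipliers

/-! ### The action on the first cohomology of the torus -/

section WindingCocycle

/-- The standard simplex is a retract of the ambient vector space. -/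
lemma exists_stdSimplex_retract (n : ℕ) : ∃ r : (Fin (n + 1) → ℝ) → stdSimplex ℝ (Fin (n + 1)),
    Continuous r ∧ ∀ x : stdSimplex ℝ (Fin (n + 1)), r x = x := by
  -- Negative coordinates are set to zero; the sum `S` of the others is corrected by adding to the
  -- first coordinate if `S < 1`, and by rescaling if `S > 1`.
  let S : (Fin (n + 1) → ℝ) → ℝ := fun x => ∑ i, max (x i) 0
  let y : (Fin (n + 1) → ℝ) → (Fin (n + 1) → ℝ) := fun x i =>
    (max (x i) 0 + (Pi.single 0 (max (1 - S x) 0) : Fin (n + 1) → ℝ) i) / max (S x) 1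
  have hS : Continuous S := by fun_prop
  have hpos : ∀ x, 0 < max (S x) 1 := fun x => lt_max_of_lt_right one_pos
  have hsingle : ∀ i, Continuous fun x => (Pi.single 0 (max (1 - S x) 0) : Fin (n + 1) → ℝ) i := by
    intro i
    by_cases hi : i = 0
    · subst hi
      simp only [Pi.single_eq_same]
      fun_prop
    · simp only [Pi.single_eq_of_ne hi]
      fun_prop
  have hy : Continuous y := by
    refine continuous_pi fun i => Continuous.div ?_ (by fun_prop) fun x => (hpos x).ne'
    exact Continuous.add (by fun_prop) (hsingle i)
  have hmem : ∀ x, y x ∈ stdSimplex ℝ (Fin (n + 1)) := by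
    intro x
    refine ⟨fun i => ?_, ?_⟩
    · refine div_nonneg (add_nonneg (le_max_right _ _) ?_) (hpos x).le
      by_cases hi : i = 0
      · subst hi
        simp
      · simp [hi]
    · simp only [y, ← Finset.sum_div, Finset.sum_add_distrib, Finset.sum_pi_single',
        Finset.mem_univ, if_true]
      rw [div_eq_one_iff_eq (hpos x).ne']
      change S x + max (1 - S x) 0 = max (S x) 1
      rw [← max_add_add_left, add_sub_cancel, add_zero, max_comm]
  refine ⟨fun x => ⟨y x, hmem x⟩, hy.subtype_mk _, fun x => ?_⟩
  have hx : ∀ i, max (x i) 0 = x i := fun i => max_eq_left (x.2.1 i)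
  have hSx : S x = 1 := by
    simp only [S, hx]
    exact x.2.2
  apply Subtype.ext
  funext i
  simp only [y]
  rw [hSx, hx]
  simp
  rfl

lemma exists_continuous_angle_stdSimplex {n : ℕ} {f : stdSimplex ℝ (Fin (n + 1)) → Circle}
    (hf : Continuous f) : ∃ k : stdSimplex ℝ (Fin (n + 1)) → ℝ, Continuous k ∧
      ∀ x, Circle.exp (2 * Real.pi * k x) = f x := by
  obtain ⟨r, hr, hr'⟩ := exists_stdSimplex_retract n
  exact exists_continuous_angle_of_retract continuous_subtype_val hr hr' hf

variable {X : Type*} [TopologicalSpace X]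

/-- The angle of a point on the circle, as a fraction of a full turn (with a jump at `-1`). -/
noncomputable def turn (u : Circle) : ℝ := Complex.arg u / (2 * Real.pi)

lemma exp_turn (u : Circle) : Circle.exp (2 * Real.pi * turn u) = u := by
  rw [turn, mul_div_cancel₀ _ (by positivity), Circle.exp_arg]

lemma exists_int_of_exp_eq {s t : ℝ}
    (h : Circle.exp (2 * Real.pi * s) = Circle.exp (2 * Real.pi * t)) : ∃ n : ℤ, s - t = n := by
  obtain ⟨m, hm⟩ := Circle.exp_eq_exp.1 h
  refine ⟨m, ?_⟩
  apply mul_left_cancel₀ (show (2 * Real.pi) ≠ 0 by positivity)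
  linear_combination hm

lemma exists_winding (q : C(X, Circle)) (σ : SingSimplex 1 X) :
    ∃ n : ℤ, ∀ k : stdSimplex ℝ (Fin 2) → ℝ, Continuous k →
      (∀ x, Circle.exp (2 * Real.pi * k x) = q (σ x)) →
      (k (stdSimplex.vertex 1) - turn (q (σ (stdSimplex.vertex 1))))
        - (k (stdSimplex.vertex 0) - turn (q (σ (stdSimplex.vertex 0)))) = n := by
  obtain ⟨k, hk, hk'⟩ := exists_continuous_angle_stdSimplex (n := 1) (f := fun x => q (σ x))
    (by fun_prop)
  have hint : ∀ x, ∃ n : ℤ, k x - turn (q (σ x)) = n := fun x =>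
    exists_int_of_exp_eq (by rw [hk', exp_turn])
  obtain ⟨a, ha⟩ := hint (stdSimplex.vertex 1)
  obtain ⟨b, hb⟩ := hint (stdSimplex.vertex 0)
  refine ⟨a - b, fun l hl hl' => ?_⟩
  obtain ⟨m, hm⟩ := exists_int_of_continuous (f := fun x => l x - k x) (by fun_prop)
    fun x => exists_int_of_exp_eq (by rw [hk', hl'])
  push_cast
  rw [← ha, ← hb]
  linear_combination hm (stdSimplex.vertex 1) - hm (stdSimplex.vertex 0)

/-- The integral singular `1`-cochain of `X` that represents the pullback under `q : X → S¹` of the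
generator of `H¹(S¹; ℤ)`: on a path it is the variation of the angle along the path, corrected at
the end points so as to be integral. -/
noncomputable def windingCochain (q : C(X, Circle)) : SingSimplex 1 X → ℤ :=
  fun σ => (exists_winding q σ).choose

lemma windingCochain_spec (q : C(X, Circle)) (σ : SingSimplex 1 X)
    {k : stdSimplex ℝ (Fin 2) → ℝ} (hk : Continuous k)
    (hk' : ∀ x, Circle.exp (2 * Real.pi * k x) = q (σ x)) :
    (windingCochain q σ : ℝ) = (k (stdSimplex.vertex 1) - turn (q (σ (stdSimplex.vertex 1))))
        - (k (stdSimplex.vertex 0) - turn (q (σ (stdSimplex.vertex 0)))) :=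
  ((exists_winding q σ).choose_spec k hk hk').symm

lemma singCoboundary_windingCochain (q : C(X, Circle)) :
    singCoboundary 1 X (windingCochain q) = 0 := by
  funext σ
  obtain ⟨k, hk, hk'⟩ := exists_continuous_angle_stdSimplex (n := 2) (f := fun x => q (σ x))
    (by fun_prop)
  have h : ∀ i : Fin 3, (windingCochain q (σ.face i) : ℝ) =
      (k (stdSimplex.vertex (i.succAbove 1)) - turn (q (σ (stdSimplex.vertex (i.succAbove 1)))))
      - (k (stdSimplex.vertex (i.succAbove 0))
        - turn (q (σ (stdSimplex.vertex (i.succAbove 0))))) := by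
    intro i
    rw [windingCochain_spec q (σ.face i) (k := fun x => k (stdSimplex.map i.succAbove x))
      (hk.comp (stdSimplex.continuous_map _)) fun x => hk' _]
    simp only [SingSimplex.face, ContinuousMap.comp_apply, ContinuousMap.coe_mk,
      stdSimplex.map_vertex]
  have h0 := h 0
  have h1 := h 1
  have h2 := h 2
  have : ((∑ i : Fin 3, (-1) ^ (i : ℕ) * windingCochain q (σ.face i) : ℤ) : ℝ) = 0 := by
    rw [Fin.sum_univ_three]
    push_cast
    rw [h0, h1, h2]
    simp [Fin.succAbove, Fin.lt_def]
  exact_mod_cast this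

/-- A self-map that acts trivially on `H¹` preserves the values of `1`-cocycles on loops. -/
lemma apply_comp_eq_of_map_eq_id {f : C(X, X)} (hf : SingH1.map f = AddMonoidHom.id (SingH1 X))
    {c : SingSimplex 1 X → ℤ} (hc : singCoboundary 1 X c = 0) {σ : SingSimplex 1 X}
    (hσ : σ (stdSimplex.vertex 0) = σ (stdSimplex.vertex 1)) : c (f.comp σ) = c σ := by
  have h := DFunLike.congr_fun hf
    (QuotientAddGroup.mk (⟨c, hc⟩ : (singCoboundary 1 X).ker) : SingH1 X)
  have h' := QuotientAddGroup.eq.1 h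
  obtain ⟨b, hb⟩ := AddSubgroup.mem_addSubgroupOf.1 h'
  have e : singCoboundary 0 X b σ = -c (f.comp σ) + c σ := congrFun hb σ
  have e0 : singCoboundary 0 X b σ = 0 := by
    change ∑ i : Fin 2, (-1) ^ (i : ℕ) * b (σ.face i) = 0
    have : σ.face 0 = σ.face 1 := by
      ext x
      obtain rfl : x = stdSimplex.vertex 0 := Subsingleton.elim _ _
      simp only [SingSimplex.face, ContinuousMap.comp_apply, ContinuousMap.coe_mk,
        stdSimplex.map_vertex]
      simpa using hσ.symm
    rw [Fin.sum_univ_two, this]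
    simp
  linarith

end WindingCocycle

/-- The action of a self-map of the torus on `H¹` determines its monodromy. -/
lemma HasMonodromy.eq_one_of_map_eq_id {f : C(Torus, Torus)} {A : ℝ × ℝ → ℝ × ℝ}
    {M : Matrix (Fin 2) (Fin 2) ℤ} (hM : HasMonodromy A M) (hA : IsTorusLift f A)
    (hf : SingH1.map f = AddMonoidHom.id (SingH1 Torus)) : M = 1 := by
  let l : (Fin 2 → ℤ) → stdSimplex ℝ (Fin 2) → ℝ × ℝ := fun z x => x 1 • latticeVec z
  have hl : ∀ z, Continuous (l z) := fun z =>
    ((continuous_apply (1 : Fin 2)).comp continuous_subtype_val).smul continuous_const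
  let σ : (Fin 2 → ℤ) → SingSimplex 1 Torus := fun z =>
    ⟨fun x => torusCover (l z x), continuous_torusCover.comp (hl z)⟩
  have hl0 : ∀ z, l z (stdSimplex.vertex 0) = 0 := fun z => by
    simp [l, stdSimplex.vertex_coe]
  have hl1 : ∀ z, l z (stdSimplex.vertex 1) = latticeVec z := fun z => by
    simp [l, stdSimplex.vertex_coe]
  have hσ : ∀ z, σ z (stdSimplex.vertex 0) = σ z (stdSimplex.vertex 1) := fun z => by
    change torusCover (l z _) = torusCover (l z _)
    rw [hl0, hl1, ← torusCover_add_latticeVec 0 z, zero_add]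
  have hA1 : ∀ z, A (latticeVec z) = A 0 + latticeVec (M.mulVec z) := fun z => by
    rw [← hM, zero_add]
  have key : ∀ (q : C(Torus, Circle)) (p : ℝ × ℝ → ℝ), Continuous p →
      (∀ x, Circle.exp (2 * Real.pi * p x) = q (torusCover x)) → ∀ z,
      p (A 0 + latticeVec (M.mulVec z)) - p (A 0) = p (latticeVec z) - p 0 := by
    intro q p hp hpq z
    have h1 := windingCochain_spec q (σ z) (hp.comp (hl z)) fun x => hpq _
    have h2 := windingCochain_spec q (f.comp (σ z)) (hp.comp (hA.continuous.comp (hl z)))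
      fun x => by
        simp only [Function.comp_apply, hpq, hA.cover]
        rfl
    rw [apply_comp_eq_of_map_eq_id hf (singCoboundary_windingCochain q) (hσ z)] at h2
    rw [h2] at h1
    simp only [Function.comp_apply, ContinuousMap.comp_apply, hl0, hl1, hσ, hA1] at h1
    linarith
  apply Matrix.ext_of_mulVec_single
  intro i
  rw [Matrix.one_mulVec]
  apply latticeVec_injective
  refine Prod.ext ?_ ?_
  · have := key ⟨Prod.fst, continuous_fst⟩ Prod.fst continuous_fst (fun x => rfl) (Pi.single i 1)
    simpa using this
  · have := key ⟨Prod.snd, continuous_snd⟩ Prod.snd continuous_snd (fun x => rfl) (Pi.single i 1)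
    simpa using this

/-! ### Monodromy of the action on the torus -/

/-- The linear self-map of the plane with the given integral matrix. -/
noncomputable def planeMap (N : Matrix (Fin 2) (Fin 2) ℤ) : ℝ × ℝ →L[ℝ] ℝ × ℝ :=
  ((N 0 0 : ℝ) • ContinuousLinearMap.fst ℝ ℝ ℝ + (N 0 1 : ℝ) • ContinuousLinearMap.snd ℝ ℝ ℝ).prod
    ((N 1 0 : ℝ) • ContinuousLinearMap.fst ℝ ℝ ℝ + (N 1 1 : ℝ) • ContinuousLinearMap.snd ℝ ℝ ℝ)

lemma hasMonodromy_planeMap (N : Matrix (Fin 2) (Fin 2) ℤ) : HasMonodromy (planeMap N) N := by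
  intro x z
  rw [map_add]
  congr 1
  simp [planeMap, latticeVec_apply]

lemma det_planeMap (N : Matrix (Fin 2) (Fin 2) ℤ) : (planeMap N).det = N.det := by
  rw [det_prod_eq, Matrix.det_fin_two]
  simp [planeMap]

/-- The invertible monodromy `M` of an orientation preserving map `A` has determinant one and not
`-1`, because `A ∘ M⁻¹` is at bounded distance from the identity and thus has degree one. -/
lemma HasMonodromy.det_eq_one {A : ℝ × ℝ → ℝ × ℝ} {M N : Matrix (Fin 2) (Fin 2) ℤ}
    (hM : HasMonodromy A M) (hA : ContDiff ℝ ∞ A) (hdet : ∀ x, 0 < (fderiv ℝ A x).det)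
    (hMN : M * N = 1) : M.det = 1 := by
  have hMN' : M.det * N.det = 1 := by rw [← Matrix.det_mul, hMN, Matrix.det_one]
  rcases Int.eq_one_or_neg_one_of_mul_eq_one hMN' with h | h
  · exact h
  have hN : N.det = -1 := by rw [h] at hMN'; linarith
  have hB : ContDiff ℝ 2 (A ∘ planeMap N) :=
    (hA.of_le (by norm_cast)).comp (planeMap N).contDiff
  obtain ⟨C, hC⟩ := exists_norm_sub_le_of_hasMonodromy_one hB.continuous
    (hMN ▸ hM.comp (hasMonodromy_planeMap N))
  obtain ⟨Φ, hΦ⟩ := exists_isTransition 0 one_pos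
  have key := hΦ.integral_mul_det_fderiv hΦ hB hC
  have hle : ∀ x, deriv Φ ((A ∘ planeMap N) x).1 * deriv Φ ((A ∘ planeMap N) x).2
      * (fderiv ℝ (A ∘ planeMap N) x).det ≤ 0 := by
    intro x
    have hd : HasFDerivAt (A ∘ planeMap N) _ x :=
      (hA.differentiable (by norm_num) (planeMap N x)).hasFDerivAt.comp x (planeMap N).hasFDerivAt
    rw [hd.fderiv, det_comp, det_planeMap, hN]
    have := mul_nonneg (mul_nonneg (hΦ.deriv_nonneg ((A ∘ planeMap N) x).1)
      (hΦ.deriv_nonneg ((A ∘ planeMap N) x).2)) (hdet (planeMap N x)).le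
    push_cast
    linarith
  have := MeasureTheory.integral_nonpos (μ := MeasureTheory.volume) hle
  linarith

/-! ### Lifts of a group action on the torus -/

section TorusAction

variable {Γ : Type*} [Group Γ] [MulAction Γ Torus]

lemma isTorusLift_one : IsTorusLift (fun x => (1 : Γ) • x) id :=
  ⟨continuous_id, fun x => by simp⟩

lemma IsTorusLift.mul {γ γ' : Γ} {A B : ℝ × ℝ → ℝ × ℝ} (hA : IsTorusLift (fun x => γ • x) A)
    (hB : IsTorusLift (fun x => γ' • x) B) : IsTorusLift (fun x => (γ * γ') • x) (A ∘ B) := by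
  have := hA.comp hB
  simpa only [Function.comp_def, smul_smul] using this

lemma IsTorusLift.pow {γ : Γ} {A : ℝ × ℝ → ℝ × ℝ} (hA : IsTorusLift (fun x => γ • x) A) (n : ℕ) :
    IsTorusLift (fun x => (γ ^ n) • x) A^[n] := by
  induction n with
  | zero => simpa using isTorusLift_one (Γ := Γ)
  | succ n ih =>
    rw [pow_succ, Function.iterate_succ]
    exact ih.mul hA

/-- The action of `Γ` on `π₁(T²) = ℤ²`. -/
lemma exists_monodromy_hom (hs : ∀ γ : Γ, ContMDiff torusModel torusModel ∞ fun x : Torus => γ • x)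
    (hor : ∀ γ : Γ, TorusOrientationPreserving fun x => γ • x) :
    ∃ φ : Γ →* Matrix.SpecialLinearGroup (Fin 2) ℤ, ∀ γ A, IsTorusLift (fun x => γ • x) A →
      HasMonodromy A (φ γ) := by
  have h : ∀ γ : Γ, ∃ M, ∀ A, IsTorusLift (fun x => γ • x) A → HasMonodromy A M := by
    intro γ
    obtain ⟨A, hA⟩ := exists_isTorusLift (hs γ).continuous
    obtain ⟨M, hM⟩ := hA.exists_hasMonodromy
    refine ⟨M, fun B hB => ?_⟩
    obtain ⟨z, hz⟩ := hA.exists_eq_add hB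
    rw [funext hz]
    exact hM.add_const _
  choose M hM using h
  choose A hA using fun γ : Γ => exists_isTorusLift (hs γ).continuous
  have hone : M 1 = 1 := (hM 1 _ isTorusLift_one).unique hasMonodromy_id
  have hmul : ∀ γ γ', M (γ * γ') = M γ * M γ' := fun γ γ' =>
    (hM _ _ ((hA γ).mul (hA γ'))).unique ((hM _ _ (hA γ)).comp (hM _ _ (hA γ')))
  have hdet : ∀ γ, (M γ).det = 1 := fun γ =>
    (hM γ _ (hA γ)).det_eq_one ((hA γ).contDiff (hs γ)) ((hA γ).det_fderiv_pos (hor γ))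
      (N := M γ⁻¹) (by rw [← hmul, mul_inv_cancel, hone])
  exact ⟨{ toFun := fun γ => ⟨M γ, hdet γ⟩
           map_one' := Subtype.ext hone
           map_mul' := fun γ γ' => Subtype.ext (hmul γ γ') }, hM⟩

/-! ### Rotation vectors -/

variable {H : Subgroup Γ}

/-- Lifts of the elements of a finite group that acts trivially on `π₁(T²)` commute: their
commutator has finite order modulo `ℤ²` and its mean displacement along an orbit vanishes, so it has
finite order, hence is the identity. -/
lemma commute_of_isTorusLift [Finite Γ]
    (hs : ∀ γ : Γ, ContMDiff torusModel torusModel ∞ fun x : Torus => γ • x)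
    (hH : ∀ γ ∈ H, ∀ A, IsTorusLift (fun x => γ • x) A → IsPeriodicMap A)
    {γ γ' : Γ} (hγ : γ ∈ H) (hγ' : γ' ∈ H) {A B : ℝ × ℝ → ℝ × ℝ}
    (hA : IsTorusLift (fun x => γ • x) A) (hB : IsTorusLift (fun x => γ' • x) B) :
    Function.Commute A B := by
  have := Fintype.ofFinite Γ
  choose x hx using fun δ : Γ => torusCover_surjective (δ • torusCover 0)
  let R : (ℝ × ℝ → ℝ × ℝ) → ℝ × ℝ := fun A => ∑ δ, (A (x δ) - x δ)
  have hR : ∀ (A B : ℝ × ℝ → ℝ × ℝ) (β : Γ), HasMonodromy A 1 → IsTorusLift (fun x => β • x) B →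
      R (A ∘ B) = R A + R B := by
    intro A B β hA hB
    have e : ∀ δ, A (B (x δ)) - B (x δ) = A (x (β * δ)) - x (β * δ) := by
      intro δ
      obtain ⟨z, hz⟩ := torusCover_eq_iff.1 (show torusCover (B (x δ)) = torusCover (x (β * δ)) by
        rw [hB.cover, hx, hx, mul_smul])
      rw [hz, hA, Matrix.one_mulVec, add_sub_add_right_eq_sub]
    have e' : R A = ∑ δ, (A (B (x δ)) - B (x δ)) := by
      simp only [e]
      exact (Equiv.sum_comp (Equiv.mulLeft β) fun δ => A (x δ) - x δ).symm
    rw [e', ← Finset.sum_add_distrib]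
    exact Finset.sum_congr rfl fun δ _ => by simp
  have hAB := hA.mul hB
  have hBA := hB.mul hA
  have hνH : γ * γ' * (γ' * γ)⁻¹ ∈ H :=
    H.mul_mem (H.mul_mem hγ hγ') (H.inv_mem (H.mul_mem hγ' hγ))
  obtain ⟨K₀, hK₀⟩ := exists_isTorusLift (hs (γ * γ' * (γ' * γ)⁻¹)).continuous
  have h1 := hK₀.mul hBA
  rw [inv_mul_cancel_right] at h1
  obtain ⟨u, hu⟩ := h1.exists_eq_add hAB
  have hK := hK₀.add_latticeVec u
  set K : ℝ × ℝ → ℝ × ℝ := fun y => K₀ y + latticeVec u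
  have hKBA : K ∘ (B ∘ A) = A ∘ B := funext fun y => (hu y).symm
  have hKp := hH _ hνH K hK
  have hRK : R K = 0 := by
    have e1 := hR K (B ∘ A) (γ' * γ) hKp.monodromy hBA
    rw [hKBA, hR A B γ' (hH _ hγ A hA).monodromy hB, hR B A γ (hH _ hγ' B hB).monodromy hA] at e1
    rw [add_comm (R B)] at e1
    exact add_eq_right.1 e1.symm
  have hRpow : ∀ n : ℕ, R K^[n] = 0 := by
    intro n
    induction n with
    | zero => simp [R]
    | succ n ih =>
      rw [Function.iterate_succ, hR _ _ _ (hKp.iterate n).monodromy hK, ih, hRK, add_zero]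
  have hKn := hK.pow (Nat.card Γ)
  rw [pow_card_eq_one'] at hKn
  obtain ⟨k, hk⟩ := isTorusLift_one.exists_eq_add hKn
  have hk0 : latticeVec k = 0 := by
    have := hRpow (Nat.card Γ)
    simp only [R, hk, id, add_sub_cancel_left, Finset.sum_const, Finset.card_univ] at this
    exact (smul_eq_zero.1 this).resolve_left Fintype.card_ne_zero
  have hKid : K = id := hKp.eq_id_of_iterate_eq_id Nat.card_pos (funext fun y => by
    rw [hk, hk0, add_zero])
  intro y
  have := congrFun hKBA y
  rw [hKid] at this
  exact this.symm

/-- `z / |Γ|` is a rotation vector of `γ`: some lift `A` of `γ` is such that `A ^ |Γ|` is the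
translation by `z`. It depends on the lift, but only modulo `ℤ²`. -/
def IsRotation (γ : Γ) (z : Fin 2 → ℤ) : Prop :=
  ∃ A, IsTorusLift (fun x => γ • x) A ∧ A^[Nat.card Γ] = deck z

lemma exists_isRotation (hs : ∀ γ : Γ, ContMDiff torusModel torusModel ∞ fun x : Torus => γ • x)
    (γ : Γ) : ∃ z, IsRotation γ z := by
  obtain ⟨A, hA⟩ := exists_isTorusLift (hs γ).continuous
  have hAn := hA.pow (Nat.card Γ)
  rw [pow_card_eq_one'] at hAn
  obtain ⟨z, hz⟩ := isTorusLift_one.exists_eq_add hAn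
  exact ⟨z, A, hA, funext hz⟩

lemma deck_iterate (u : Fin 2 → ℤ) (n : ℕ) : (deck u)^[n] = deck (n • u) := by
  induction n with
  | zero => funext x; simp [deck]
  | succ n ih => rw [Function.iterate_succ, ih, deck_comp, succ_nsmul]

namespace IsRotation

variable {γ γ' : Γ} {z w : Fin 2 → ℤ}

lemma add_card_smul (hH : ∀ γ ∈ H, ∀ A, IsTorusLift (fun x => γ • x) A → IsPeriodicMap A)
    (hγ : γ ∈ H) (hz : IsRotation γ z) (u : Fin 2 → ℤ) : IsRotation γ (z + Nat.card Γ • u) := by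
  obtain ⟨A, hA, hAz⟩ := hz
  have hcomm : Function.Commute (deck u) A := fun x => by
    rw [deck, deck, (hH γ hγ A hA).monodromy, Matrix.one_mulVec]
  refine ⟨deck u ∘ A, hA.add_latticeVec u, ?_⟩
  rw [hcomm.comp_iterate, hAz, deck_iterate, deck_comp, add_comm]

lemma exists_eq_add (hH : ∀ γ ∈ H, ∀ A, IsTorusLift (fun x => γ • x) A → IsPeriodicMap A)
    (hγ : γ ∈ H) (hz : IsRotation γ z) (hw : IsRotation γ w) :
    ∃ u, w = z + Nat.card Γ • u := by
  obtain ⟨A, hA, hAz⟩ := hz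
  obtain ⟨B, hB, hBw⟩ := hw
  obtain ⟨u, hu⟩ := hA.exists_eq_add hB
  have hcomm : Function.Commute (deck u) A := fun x => by
    rw [deck, deck, (hH γ hγ A hA).monodromy, Matrix.one_mulVec]
  have hBA : B = deck u ∘ A := funext hu
  rw [hBA, hcomm.comp_iterate, hAz, deck_iterate, deck_comp] at hBw
  refine ⟨u, latticeVec_injective ?_⟩
  have := congrFun hBw 0
  simp only [deck, zero_add] at this
  rw [← this, add_comm]

lemma mul [Finite Γ] (hs : ∀ γ : Γ, ContMDiff torusModel torusModel ∞ fun x : Torus => γ • x)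
    (hH : ∀ γ ∈ H, ∀ A, IsTorusLift (fun x => γ • x) A → IsPeriodicMap A)
    (hγ : γ ∈ H) (hγ' : γ' ∈ H) (hz : IsRotation γ z) (hw : IsRotation γ' w) :
    IsRotation (γ * γ') (z + w) := by
  obtain ⟨A, hA, hAz⟩ := hz
  obtain ⟨B, hB, hBw⟩ := hw
  refine ⟨A ∘ B, hA.mul hB, ?_⟩
  rw [(commute_of_isTorusLift hs hH hγ hγ' hA hB).comp_iterate, hAz, hBw, deck_comp]

end IsRotation

/-! ### Abelian subgroups of small index -/

variable {E : Torus → Type*}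
  [∀ x, AddCommGroup (E x)] [∀ x, Module ℂ (E x)] [TopologicalSpace (TotalSpace ℂ E)]
  [∀ x, TopologicalSpace (E x)] [FiberBundle ℂ E] [VectorBundle ℂ ℂ E]
  [Finite Γ] [MulAction Γ (TotalSpace ℂ E)] [FaithfulSMul Γ (TotalSpace ℂ E)]

/-- Two elements commute if the area spanned by their rotation vectors, times the degree, is
zero. -/
lemma IsRotation.mul_comm_of_eq_zero (hΓ : IsLineBundleAction Γ E)
    (hH : ∀ γ ∈ H, ∀ A, IsTorusLift (fun x => γ • x) A → IsPeriodicMap A) {γ γ' : Γ}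
    (hγ : γ ∈ H) (hγ' : γ' ∈ H) {z w : Fin 2 → ℤ} (hz : IsRotation γ z) (hw : IsRotation γ' w)
    (h0 : lineDegree E * (z 0 * w 1 - z 1 * w 0) = 0) : γ * γ' = γ' * γ := by
  obtain ⟨σ, hσ⟩ := exists_isPlaneFrame E
  obtain ⟨A, hA, hAz⟩ := hz
  obtain ⟨B, hB, hBw⟩ := hw
  have hAB := commute_of_isTorusLift hΓ.contMDiff_base hH hγ hγ' hA hB
  obtain ⟨c, hc⟩ := hΓ.exists_isLogCommutator hσ hA hB hAB
  rw [← hc.exp_eq_one_iff hΓ hσ hAB, Complex.exp_eq_one_iff]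
  have hsq := hc.card_sq_mul_eq hΓ hσ hAB hAz hBw
  have h0' : (lineDegree E : ℂ) * (z 0 * w 1 - z 1 * w 0) = 0 := by exact_mod_cast h0
  rw [mul_assoc _ (lineDegree E : ℂ), h0', mul_zero] at hsq
  have hn : (Nat.card Γ : ℂ) ^ 2 ≠ 0 := pow_ne_zero _ (by exact_mod_cast Nat.card_pos.ne')
  exact ⟨0, by simpa using (mul_eq_zero.1 hsq).resolve_left hn⟩

/-- The second coordinate of a rotation vector, times the degree, is an integer: the translation by
`(1, 0)` lifts the neutral element and thus commutes with everything. -/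
lemma IsRotation.card_dvd (hΓ : IsLineBundleAction Γ E)
    (hH : ∀ γ ∈ H, ∀ A, IsTorusLift (fun x => γ • x) A → IsPeriodicMap A) {γ : Γ}
    (hγ : γ ∈ H) {z : Fin 2 → ℤ} (hz : IsRotation γ z) :
    (Nat.card Γ : ℤ) ∣ lineDegree E * z 1 := by
  obtain ⟨σ, hσ⟩ := exists_isPlaneFrame E
  obtain ⟨A, hA, hAz⟩ := hz
  have hTA : ∀ x, deck (Pi.single 0 1) (A x) = A (deck (Pi.single 0 1) x) := fun x => by
    rw [deck, deck, (hH γ hγ A hA).monodromy, Matrix.one_mulVec]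
  obtain ⟨c, hc⟩ := hΓ.exists_isLogCommutator hσ (isTorusLift_deck (Γ := Γ) (Pi.single 0 1)) hA hTA
  obtain ⟨m, hm⟩ := Complex.exp_eq_one_iff.1
    ((hc.exp_eq_one_iff hΓ hσ hTA).2 (by rw [one_mul, mul_one]))
  have hsq := hc.card_sq_mul_eq hΓ hσ hTA (deck_iterate _ _) hAz
  have hn : (Nat.card Γ : ℂ) ≠ 0 := by exact_mod_cast Nat.card_pos.ne'
  refine ⟨m, ?_⟩
  have : (2 * Real.pi * Complex.I * Nat.card Γ) * ((lineDegree E : ℂ) * z 1)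
      = (2 * Real.pi * Complex.I * Nat.card Γ) * (Nat.card Γ * m) := by
    rw [hm] at hsq
    simp only [Pi.smul_apply, Pi.single_eq_same, nsmul_eq_mul, mul_one, ne_eq, one_ne_zero,
      not_false_eq_true, Pi.single_eq_of_ne, mul_zero] at hsq
    push_cast at hsq
    linear_combination -hsq
  exact_mod_cast mul_left_cancel₀ (mul_ne_zero Complex.two_pi_I_ne_zero hn) this

/-- If the subgroup `H` acts trivially on `π₁(T²)`, then the elements of `H` whose rotation vector
has integral second coordinate form an abelian subgroup, of index at most `|deg E|` in `H` unless
the degree is zero. -/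
lemma exists_abelian_subgroup (hΓ : IsLineBundleAction Γ E)
    (hH : ∀ γ ∈ H, ∀ A, IsTorusLift (fun x => γ • x) A → IsPeriodicMap A) :
    ∃ K : Subgroup Γ, (∀ a ∈ K, ∀ b ∈ K, a * b = b * a) ∧
      K.index ≤ H.index * max 1 (lineDegree E).natAbs := by
  have hs := hΓ.contMDiff_base
  choose z hz using fun γ : Γ => exists_isRotation hs γ
  rcases eq_or_ne (lineDegree E) 0 with hd | hd
  · refine ⟨H, fun a ha b hb => ?_, by simp [hd]⟩
    exact (hz a).mul_comm_of_eq_zero hΓ hH ha hb (hz b) (by rw [hd, zero_mul])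
  have hn : (Nat.card Γ : ℂ) ≠ 0 := by exact_mod_cast Nat.card_pos.ne'
  let e : ℤ → ℂ := fun m => Complex.exp (2 * Real.pi * Complex.I * m / Nat.card Γ)
  have heq : ∀ {m m' : ℤ}, e m = e m' ↔ ∃ u : ℤ, m = m' + Nat.card Γ * u := by
    intro m m'
    simp only [e, Complex.exp_eq_exp_iff_exists_int]
    refine exists_congr fun u => ?_
    rw [div_eq_iff hn, add_mul, div_mul_cancel₀ _ hn]
    constructor
    · intro h
      have : (2 * Real.pi * Complex.I) * (m : ℂ)
          = (2 * Real.pi * Complex.I) * (m' + Nat.card Γ * u) := by linear_combination h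
      exact_mod_cast mul_left_cancel₀ Complex.two_pi_I_ne_zero this
    · intro h
      rw [h]
      push_cast
      ring
  have hadd : ∀ m m', e (m + m') = e m * e m' := by
    intro m m'
    simp only [e, ← Complex.exp_add]
    congr 1
    push_cast
    ring
  have he0 : e 0 = 1 := by simp [e]
  let χ : H →* ℂ :=
    { toFun := fun γ => e (z γ 1)
      map_one' := by
        have h1 : IsRotation (1 : Γ) (0 : Fin 2 → ℤ) :=
          ⟨id, isTorusLift_one, by funext x; simp [deck]⟩
        obtain ⟨u, hu⟩ := h1.exists_eq_add hH H.one_mem (hz 1)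
        rw [← he0]
        exact heq.2 ⟨u 1, by simp [hu]⟩
      map_mul' := fun γ γ' => by
        have h1 := (hz γ.1).mul hs hH γ.2 γ'.2 (hz γ'.1)
        obtain ⟨u, hu⟩ := h1.exists_eq_add hH (H.mul_mem γ.2 γ'.2) (hz (γ.1 * γ'.1))
        rw [← hadd]
        exact heq.2 ⟨u 1, by simp [hu]⟩ }
  let ψ : H →* ℂˣ := χ.toHomUnits
  have hψ : ∀ γ, (ψ γ : ℂ) = e (z γ 1) := fun γ => rfl
  have hker : ∀ γ : H, γ ∈ ψ.ker → ∃ w, IsRotation γ.1 w ∧ w 1 = 0 := by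
    intro γ hγ
    have h1 : e (z γ 1) = e 0 := by
      rw [← hψ, MonoidHom.mem_ker.1 hγ, he0, Units.val_one]
    obtain ⟨u, hu⟩ := heq.1 h1
    exact ⟨_, (hz γ.1).add_card_smul hH γ.2 (Pi.single 1 (-u)), by simp [hu]⟩
  have hd' : (lineDegree E).natAbs ≠ 0 := Int.natAbs_ne_zero.2 hd
  have : NeZero (lineDegree E).natAbs := ⟨hd'⟩
  have hrange : ψ.range ≤ rootsOfUnity (lineDegree E).natAbs ℂ := by
    rintro _ ⟨γ, rfl⟩
    rw [mem_rootsOfUnity]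
    ext
    rw [Units.val_pow_eq_pow_val, Units.val_one, hψ]
    have hpow : e (z γ 1) ^ (lineDegree E).natAbs = e ((lineDegree E).natAbs * z γ 1) := by
      simp only [e]
      rw [← Complex.exp_nat_mul]
      congr 1
      rw [Int.cast_mul, Int.cast_natCast]
      ring
    rw [hpow, ← he0, heq]
    have hdvd : (Nat.card Γ : ℤ) ∣ (lineDegree E).natAbs * z γ 1 := by
      have h := (hz γ.1).card_dvd hΓ hH γ.2
      rw [Int.natCast_natAbs]
      rcases abs_choice (lineDegree E) with h' | h' <;> rw [h']
      · exact h
      · rwa [neg_mul, dvd_neg]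
    obtain ⟨u, hu⟩ := hdvd
    exact ⟨u, by rw [hu, zero_add]⟩
  have hindex : ψ.ker.index ≤ (lineDegree E).natAbs := by
    rw [Subgroup.index_ker]
    exact (Nat.card_le_card_of_injective _ (Subgroup.inclusion_injective hrange)).trans
      (card_rootsOfUnity ℂ _)
  refine ⟨ψ.ker.map H.subtype, ?_, ?_⟩
  · rintro _ ⟨a, ha, rfl⟩ _ ⟨b, hb, rfl⟩
    obtain ⟨v, hv, hv0⟩ := hker a ha
    obtain ⟨w, hw, hw0⟩ := hker b hb
    exact hv.mul_comm_of_eq_zero hΓ hH a.2 b.2 hw (by rw [hv0, hw0]; ring)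
  · rw [Subgroup.index_map_subtype, mul_comm]
    exact Nat.mul_le_mul_left _ (hindex.trans (le_max_right _ _))

end TorusAction

theorem proposition2p9 {E : Torus → Type*}
    [∀ x, AddCommGroup (E x)] [∀ x, Module ℂ (E x)] [TopologicalSpace (TotalSpace ℂ E)]
    [∀ x, TopologicalSpace (E x)] [FiberBundle ℂ E] [VectorBundle ℂ ℂ E]
    [ContMDiffVectorBundle ∞ ℂ E torusModel]
    {Γ : Type*} [Group Γ] [Finite Γ] [MulAction Γ Torus] [MulAction Γ (TotalSpace ℂ E)]
    [FaithfulSMul Γ (TotalSpace ℂ E)]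
    (hΓ : IsLineBundleAction Γ E)
    (hor : ∀ γ : Γ, TorusOrientationPreserving fun x => γ • x) :
    (∃ A : Subgroup Γ, (∀ a ∈ A, ∀ b ∈ A, a * b = b * a) ∧
      A.index ≤ 6 * max 1 (lineDegree E).natAbs) ∧
    ((∀ γ : Γ, SingH1.map (hΓ.baseMap γ) = AddMonoidHom.id (SingH1 Torus)) →
      FactorsThroughFreeTwoGeneratedAbelian Γ Torus →
      ∃ A : Subgroup Γ, (∀ a ∈ A, ∀ b ∈ A, a * b = b * a) ∧
        A.index ≤ max 1 (lineDegree E).natAbs) := by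
  have hper : ∀ (γ : Γ) (A : ℝ × ℝ → ℝ × ℝ), IsTorusLift (fun x => γ • x) A →
      HasMonodromy A 1 → IsPeriodicMap A := fun γ A hA h1 =>
    ⟨hA.contDiff (hΓ.contMDiff_base γ), hA.det_fderiv_pos (hor γ), h1⟩
  constructor
  · obtain ⟨φ, hφ⟩ := exists_monodromy_hom hΓ.contMDiff_base hor
    obtain ⟨K, hK, hKi⟩ := exists_abelian_subgroup (H := φ.ker) hΓ fun γ hγ A hA =>
      hper γ A hA (by
        have := hφ γ A hA
        rwa [MonoidHom.mem_ker.1 hγ, Matrix.SpecialLinearGroup.coe_one] at this)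
    exact ⟨K, hK, hKi.trans (Nat.mul_le_mul_right _ (index_ker_specialLinearGroup_le φ))⟩
  · intro hcoh _
    obtain ⟨K, hK, hKi⟩ := exists_abelian_subgroup (H := ⊤) hΓ fun γ _ A hA => by
      obtain ⟨M, hM⟩ := hA.exists_hasMonodromy
      exact hper γ A hA (hM.eq_one_of_map_eq_id (f := hΓ.baseMap γ) hA (hcoh γ) ▸ hM)
    exact ⟨K, hK, by simpa using hKi⟩
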